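/- Let $A:\mathbb R^n\to\mathbb R^n$ be linear, let $C\subset\mathbb R^n$ be a polyhedral set (an intersection of finitely many closed half-spaces), and let $N(C,x)=\{y:\langle y,u-x\rangle\le 0\ \forall u\in C\}$ for $x\in C$, $N(C,x)=\emptyset$ for $x\notin C$. Put $\Phi(x)=Ax+N(C,x)$ and let $S(z)=\Phi^{-1}(z)=\{x: z\in Ax+N(C,x)\}$ be the solution mapping of the linear variational inequality $z\in Ax+N(C,x)$. Let $\bar x\in S(\bar z)$. (a) If $\Phi$ is metrically regular near $(\bar x,\bar z)$, i.e. there is $\kappa>0$ with $d(x,\Phi^{-1}(z))\le\kappa\, d(z,\Phi(x))$ for all $(x,z)$ close to $(\bar x,\bar z)$ (with $d(\cdot,\emptyset)=\infty$), then $\Phi$ is strongly regular near $(\bar x,\bar z)$, i.e. it is metrically regular there and there is $\delta>0$ such that $\Phi(x)\cap\Phi(u)\cap B(\bar z,\delta)=\emptyset$ for all distinct $x,u$ sufficiently close to $\bar x$. (b) The solution mapping is single-valued and Lipschitz around $(\bar x,\bar z)$ (i.e. for some $\varepsilon>0$ the mapping $z\mapsto S(z)\cap B(\bar x,\varepsilon)$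 is single-valued and Lipschitz on a neighborhood of $\bar z$) if and only if the critical face condition holds, that is: for any two nonempty faces $F_1\subset F_2$ of the critical cone $$K=\{h\in T(C,\bar x):\ \langle \bar z-A\bar x,h\rangle=0\},$$ where $T(C,\bar x)$ is the tangent cone to $C$ at $\bar x$, $$z\in \operatorname{cone}(F_2-F_1),\quad A^*z\in (F_2-F_1)^\circ\ \Longrightarrow\ z=0 .$$ Here $A^*$ is the adjoint of $A$, $\operatorname{cone}(\cdot)$ is the generated cone, and $Q^\circ=\{y:\langle y,q\rangle\le0\ \forall q\in Q\}$ is the polar cone. -/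

import Mathlib

open scoped Topology NNReal ENNReal Pointwise RealInnerProductSpace

namespace LinearVI

/-! ### Set-valued mappings and their regularity -/

/-- The inverse of a set-valued mapping: `F⁻¹(y) = {x : y ∈ F(x)}`. -/
def inv {X Y : Type*} (F : X → Set Y) (y : Y) : Set X :=
  {x | y ∈ F x}

/-- `F` is metrically regular near `(x₀, y₀)` (a point of its graph): there is `κ > 0` with
`d(x, F⁻¹(y)) ≤ κ d(y, F(x))` for all `(x, y)` close to `(x₀, y₀)`.
Distances are extended, so the distance to the empty set is `∞`. -/
def MetricallyRegularNear {X Y : Type*} [PseudoMetricSpace X] [PseudoMetricSpace Y]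
    (F : X → Set Y) (x₀ : X) (y₀ : Y) : Prop :=
  y₀ ∈ F x₀ ∧ ∃ κ : ℝ≥0, 0 < κ ∧
    ∀ᶠ p : X × Y in 𝓝 (x₀, y₀),
      Metric.infEDist p.1 (inv F p.2) ≤ (κ : ℝ≥0∞) * Metric.infEDist p.2 (F p.1)

/-- `F` is strongly regular near `(x₀, y₀)`: it is metrically regular there and, for some `δ > 0`,
`F(x) ∩ F(u) ∩ B(y₀, δ) = ∅` for all distinct `x, u` sufficiently close to `x₀`. -/
def StronglyRegularNear {X Y : Type*} [PseudoMetricSpace X] [PseudoMetricSpace Y]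
    (F : X → Set Y) (x₀ : X) (y₀ : Y) : Prop :=
  MetricallyRegularNear F x₀ y₀ ∧
    ∃ δ > 0, ∃ U ∈ 𝓝 x₀, ∀ x ∈ U, ∀ u ∈ U, x ≠ u → F x ∩ F u ∩ Metric.ball y₀ δ = ∅

/-- The set-valued mapping `S` (from `Y` to `X`) is single-valued and Lipschitz around
`(x₀, y₀)`: for some `ε > 0`, the mapping `y ↦ S(y) ∩ B(x₀, ε)` coincides on a neighborhood of
`y₀` with a single-valued Lipschitz mapping. -/
def SingleValuedLipschitzAround {X Y : Type*} [PseudoMetricSpace X] [PseudoMetricSpace Y]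
    (S : Y → Set X) (x₀ : X) (y₀ : Y) : Prop :=
  ∃ ε > 0, ∃ V ∈ 𝓝 y₀, ∃ s : Y → X, ∃ L : ℝ≥0,
    LipschitzOnWith L s V ∧ ∀ y ∈ V, S y ∩ Metric.ball x₀ ε = {s y}

/-! ### Convex geometry -/

section Convex

variable {E : Type*} [NormedAddCommGroup E] [InnerProductSpace ℝ E]

/-- A polyhedral set: an intersection of finitely many closed half-spaces. -/
def IsPolyhedral (C : Set E) : Prop :=
  ∃ (k : ℕ) (a : Fin k → E) (α : Fin k → ℝ),
    (∀ i, a i ≠ 0) ∧ C = {x | ∀ i, ⟪a i, x⟫ ≤ α i}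

/-- The normal cone to `C` at `x`; it is empty if `x ∉ C`. -/
def normalCone (C : Set E) (x : E) : Set E :=
  {y | x ∈ C ∧ ∀ u ∈ C, ⟪y, u - x⟫ ≤ 0}

/-- `F` is a face of the convex set `C`: a nonempty closed convex subset of `C` containing every
segment in `C` that has a relative interior point in `F`. -/
def IsFace (C F : Set E) : Prop :=
  F.Nonempty ∧ IsClosed F ∧ Convex ℝ F ∧ IsExtreme ℝ C F

/-- The cone generated by `S`; it is convex if `S` is. -/
def coneOf (S : Set E) : Set E :=
  {z | ∃ t : ℝ, 0 ≤ t ∧ ∃ w ∈ S, z = t • w}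

/-- The polar cone `{y : ⟪y, x⟫ ≤ 0 for all x ∈ S}`. -/
def polarCone (S : Set E) : Set E :=
  {y | ∀ x ∈ S, ⟪y, x⟫ ≤ 0}

/-- The critical cone to `C` at `x` for `v ∈ N(C, x)`: the vectors of the tangent (contingent)
cone `T(C, x)` that are orthogonal to `v`. -/
def criticalCone (C : Set E) (x v : E) : Set E :=
  {h | h ∈ posTangentConeAt C x ∧ ⟪v, h⟫ = 0}

/-- The critical face condition for `A` on `K`: for all faces `F₁ ⊆ F₂` of `K`,
`z ∈ cone (F₂ - F₁)` and `A* z ∈ (cone (F₂ - F₁))°` imply `z = 0`. -/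
def CriticalFaceCondition [FiniteDimensional ℝ E] (A : E →ₗ[ℝ] E) (K : Set E) : Prop :=
  ∀ F₁ F₂ : Set E, IsFace K F₁ → IsFace K F₂ → F₁ ⊆ F₂ →
    ∀ z ∈ coneOf (F₂ - F₁), LinearMap.adjoint A z ∈ polarCone (coneOf (F₂ - F₁)) → z = 0

/-- The set-valued mapping `Φ(x) = A x + N(C, x)`. -/
def viMap (A : E →ₗ[ℝ] E) (C : Set E) (x : E) : Set E :=
  {z | ∃ y ∈ normalCone C x, z = A x + y}

/-- The solution mapping `S(z) = {x : z ∈ A x + N(C, x)}` of the variational inequality. -/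
def solutionMap (A : E →ₗ[ℝ] E) (C : Set E) : E → Set E :=
  inv (viMap A C)

end Convex

end LinearVI

/-! Let P be the projection onto C and f = A∘P + (id − P) the normal map. The map u ↦ (P u, f u)
parametrizes the graph of Φ, with Lipschitz inverse (h, z) ↦ h + (z − A h). Regularity of Φ thus
becomes openness of f at a linear rate, and uniqueness of solutions becomes injectivity of f. By
`eventually_proj_add`, f agrees near each point, up to translations, with the normal map of a
critical cone. Such a map is positively homogeneous, so its local and global properties agree, and
it suffices to study the normal map of a polyhedral cone K.

Criterion for openness: f is linearly open iff no critical cone K' of K contains a nonzero z with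
A*z in the polar of K'. If f is open, so are its local models; each is surjective, and writing z as
a value gives ⟪z, z⟫ ≤ 0. Conversely, nondegeneracy yields directions along which ‖f − z‖ decreases
at a uniform rate (`CritNondegenerate.linearlyOpen`). The critical cones of K are exactly the cones
generated by F₂ − F₁, so this is the critical face condition.

Openness implies injectivity (`LinearlyOpen.injective_normalMap`), by induction on the codimension
of the subspace B of trivial directions. The local model at a point off B has more trivial
directions, so f is locally injective off B; it is also proper and open, hence a covering over the
complement of f(B). In codimension at least three, two points with equal images are joined by a path
whose image lies in a contractible open set, so they coincide. In codimension one or two, a second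
preimage would produce more points in pairwise different cells than there are cells. -/

namespace LinearVI

/-! ### Metric projection onto a closed convex set -/

section Projection

variable {E : Type*} [NormedAddCommGroup E] [InnerProductSpace ℝ E]

/-- The metric projection onto `C`, characterized by `x - proj C x ∈ normalCone C (proj C x)`. -/
noncomputable def proj (C : Set E) (x : E) : E :=
  Classical.epsilon fun p => x - p ∈ normalCone C p

theorem normalCone_monotone {C : Set E} {h k y v : E} (hy : y ∈ normalCone C h)
    (hv : v ∈ normalCone C k) : 0 ≤ ⟪y - v, h - k⟫ := by
  have h1 := hy.2 k hv.1
  have h2 := hv.2 h hy.1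
  have e1 : ⟪y, k - h⟫ = -⟪y, h - k⟫ := by rw [← inner_neg_right, neg_sub]
  rw [inner_sub_left]
  linarith

/-- Monotonicity of the normal cone makes the defining inclusion have at most one solution. Neither
convexity nor closedness is needed. -/
theorem proj_eq_of_mem {C : Set E} {x p : E} (h : x - p ∈ normalCone C p) : proj C x = p := by
  have h' : x - proj C x ∈ normalCone C (proj C x) :=
    Classical.epsilon_spec (p := fun p => x - p ∈ normalCone C p) ⟨p, h⟩
  have := normalCone_monotone h' h
  have e : x - proj C x - (x - p) = -(proj C x - p) := by abel
  rw [e, inner_neg_left, real_inner_self_eq_norm_sq] at this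
  have h0 : ‖proj C x - p‖ = 0 := by
    have : ‖proj C x - p‖ ^ 2 ≤ 0 := by linarith
    nlinarith [norm_nonneg (proj C x - p)]
  exact sub_eq_zero.1 (norm_eq_zero.1 h0)

theorem proj_add_of_mem {C : Set E} {h y : E} (hy : y ∈ normalCone C h) : proj C (h + y) = h :=
  proj_eq_of_mem (by simpa using hy)

variable [FiniteDimensional ℝ E]

theorem sub_proj_mem {C : Set E} (hne : C.Nonempty) (hcl : IsClosed C) (hcv : Convex ℝ C) (x : E) :
    x - proj C x ∈ normalCone C (proj C x) := by
  have : CompleteSpace E := FiniteDimensional.complete ℝ E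
  obtain ⟨p, hp, hmin⟩ := exists_norm_eq_iInf_of_complete_convex hne hcl.isComplete hcv x
  have h := (norm_eq_iInf_iff_real_inner_le_zero hcv hp).1 hmin
  exact Classical.epsilon_spec (p := fun p => x - p ∈ normalCone C p) ⟨p, hp, h⟩

theorem norm_proj_sub_le {C : Set E} (hne : C.Nonempty) (hcl : IsClosed C) (hcv : Convex ℝ C)
    (x u : E) : ‖proj C x - proj C u‖ ≤ ‖x - u‖ := by
  have h := normalCone_monotone (sub_proj_mem hne hcl hcv x) (sub_proj_mem hne hcl hcv u)
  have e : x - proj C x - (u - proj C u) = (x - u) - (proj C x - proj C u) := by abel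
  rw [e, inner_sub_left, real_inner_self_eq_norm_sq] at h
  have := real_inner_le_norm (x - u) (proj C x - proj C u)
  by_contra! hlt
  nlinarith [norm_nonneg (x - u), norm_nonneg (proj C x - proj C u)]

theorem continuous_proj {C : Set E} (hne : C.Nonempty) (hcl : IsClosed C) (hcv : Convex ℝ C) :
    Continuous (proj C) := by
  have : LipschitzWith 1 (proj C) := LipschitzWith.of_dist_le_mul fun x u => by
    simpa [dist_eq_norm] using norm_proj_sub_le hne hcl hcv x u
  exact this.continuous

end Projection

/-! ### Polyhedra, their critical cones, and the local form of the projection -/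

section Polyhedron

variable {E : Type*} [NormedAddCommGroup E] [InnerProductSpace ℝ E]

/-- The intersection of the half-spaces `⟪a i, x⟫ ≤ α i`. -/
def polyhedron {ι : Type*} (a : ι → E) (α : ι → ℝ) : Set E :=
  {x | ∀ i, ⟪a i, x⟫ ≤ α i}

/-- The cone of all `x` with `⟪a, x⟫ ≤ 0` for `a ∈ S`. -/
def polyCone (S : Set E) : Set E :=
  {x | ∀ a ∈ S, ⟪a, x⟫ ≤ 0}

theorem polyCone_eq_polyhedron (S : Set E) :
    polyCone S = polyhedron (fun a : S => (a : E)) 0 := by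
  ext x; simp [polyCone, polyhedron]

theorem isClosed_polyhedron {ι : Type*} (a : ι → E) (α : ι → ℝ) : IsClosed (polyhedron a α) := by
  have : polyhedron a α = ⋂ i, {x | ⟪a i, x⟫ ≤ α i} := by ext; simp [polyhedron]
  rw [this]
  exact isClosed_iInter fun i => isClosed_le (by fun_prop) continuous_const

theorem convex_polyhedron {ι : Type*} (a : ι → E) (α : ι → ℝ) : Convex ℝ (polyhedron a α) := by
  intro x hx u hu s t hs ht hst i
  rw [inner_add_right, inner_smul_right, inner_smul_right]
  have := hx i
  have := hu i
  calc s * ⟪a i, x⟫ + t * ⟪a i, u⟫ ≤ s * α i + t * α i := by gcongr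
    _ = α i := by rw [← add_mul, hst, one_mul]

theorem isClosed_polyCone (S : Set E) : IsClosed (polyCone S) := by
  rw [polyCone_eq_polyhedron]; exact isClosed_polyhedron _ _

theorem convex_polyCone (S : Set E) : Convex ℝ (polyCone S) := by
  rw [polyCone_eq_polyhedron]; exact convex_polyhedron _ _

theorem zero_mem_polyCone (S : Set E) : (0 : E) ∈ polyCone S := fun a _ => by simp

theorem nonempty_polyCone (S : Set E) : (polyCone S).Nonempty := ⟨0, zero_mem_polyCone S⟩

theorem smul_mem_polyCone {S : Set E} {x : E} (hx : x ∈ polyCone S) {t : ℝ} (ht : 0 ≤ t) :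
    t • x ∈ polyCone S := fun a ha => by
  rw [inner_smul_right]; exact mul_nonpos_of_nonneg_of_nonpos ht (hx a ha)

theorem add_mem_polyCone {S : Set E} {x u : E} (hx : x ∈ polyCone S) (hu : u ∈ polyCone S) :
    x + u ∈ polyCone S := fun a ha => by
  rw [inner_add_right]; exact add_nonpos (hx a ha) (hu a ha)

theorem mem_normalCone_polyCone {S : Set E} {h y : E} :
    y ∈ normalCone (polyCone S) h ↔
      h ∈ polyCone S ∧ (∀ k ∈ polyCone S, ⟪y, k⟫ ≤ 0) ∧ ⟪y, h⟫ = 0 := by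
  constructor
  · rintro ⟨hh, hy⟩
    have h0 : ⟪y, h⟫ = 0 := by
      have h1 := hy 0 (zero_mem_polyCone S)
      -- Testing against 0 and 2h gives opposite signs for ⟪y, h⟫.
      have h2 := hy ((2 : ℝ) • h) (smul_mem_polyCone hh (by norm_num))
      rw [zero_sub, inner_neg_right] at h1
      rw [two_smul, add_sub_cancel_right] at h2
      linarith
    refine ⟨hh, fun k hk => ?_, h0⟩
    have := hy k hk
    rw [inner_sub_right, h0] at this
    linarith
  · rintro ⟨hh, hy, h0⟩
    refine ⟨hh, fun k hk => ?_⟩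
    rw [inner_sub_right, h0, sub_zero]
    exact hy k hk

/-- For small `t > 0` the point `h + t w` stays in a polyhedron if `w` satisfies the constraints
active at `h`. -/
theorem eventually_add_smul_mem_polyhedron {ι : Type*} [Finite ι] {a : ι → E} {α : ι → ℝ} {h w : E}
    (hh : h ∈ polyhedron a α) (hw : ∀ i, ⟪a i, h⟫ = α i → ⟪a i, w⟫ ≤ 0) :
    ∀ᶠ t : ℝ in 𝓝[≥] 0, h + t • w ∈ polyhedron a α := by
  have : ∀ i, ∀ᶠ t : ℝ in 𝓝[≥] 0, ⟪a i, h + t • w⟫ ≤ α i := by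
    intro i
    rcases (hh i).lt_or_eq with hlt | heq
    · have hc : ContinuousAt (fun t : ℝ => ⟪a i, h + t • w⟫) 0 := by fun_prop
      have := hc.eventually_lt (continuousAt_const (y := α i)) (by simpa using hlt)
      exact (this.filter_mono nhdsWithin_le_nhds).mono fun t ht => ht.le
    · filter_upwards [self_mem_nhdsWithin] with t ht
      rw [inner_add_right, inner_smul_right, heq]
      have := mul_nonpos_of_nonneg_of_nonpos (Set.mem_Ici.1 ht) (hw i heq)
      linarith
  exact Filter.eventually_all.2 this

theorem mem_posTangentConeAt_polyhedron {ι : Type*} [Finite ι] {a : ι → E} {α : ι → ℝ} {h w : E}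
    (hh : h ∈ polyhedron a α) :
    w ∈ posTangentConeAt (polyhedron a α) h ↔ ∀ i, ⟪a i, h⟫ = α i → ⟪a i, w⟫ ≤ 0 := by
  constructor
  · intro hw i hi
    have hmax : IsLocalMaxOn (fun x => ⟪a i, x⟫) (polyhedron a α) h :=
      Filter.eventually_of_mem self_mem_nhdsWithin fun x hx => by
        change ⟪a i, x⟫ ≤ ⟪a i, h⟫
        rw [hi]; exact hx i
    exact hmax.hasFDerivWithinAt_nonpos (innerSL ℝ (a i)).hasFDerivAt.hasFDerivWithinAt hw
  · intro hw
    apply mem_posTangentConeAt_of_frequently_mem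
    exact ((eventually_add_smul_mem_polyhedron hh hw).filter_mono
      (nhdsWithin_mono _ Set.Ioi_subset_Ici_self)).frequently

theorem mem_criticalCone_polyhedron {ι : Type*} [Finite ι] {a : ι → E} {α : ι → ℝ} {h y w : E}
    (hh : h ∈ polyhedron a α) :
    w ∈ criticalCone (polyhedron a α) h y ↔
      (∀ i, ⟪a i, h⟫ = α i → ⟪a i, w⟫ ≤ 0) ∧ ⟪y, w⟫ = 0 := by
  rw [criticalCone, Set.mem_ofPred_eq, mem_posTangentConeAt_polyhedron hh]

/-- The equation ⟪y, w⟫ = 0 is encoded by the two normals y and −y, so that critical cones stay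
within the class `polyCone` and the reduction can be iterated. -/
theorem criticalCone_polyhedron {ι : Type*} [Finite ι] {a : ι → E} {α : ι → ℝ} {h : E} (y : E)
    (hh : h ∈ polyhedron a α) :
    criticalCone (polyhedron a α) h y =
      polyCone (a '' {i | ⟪a i, h⟫ = α i} ∪ {y, -y}) := by
  ext w
  rw [mem_criticalCone_polyhedron hh]
  simp only [polyCone, Set.mem_union, Set.mem_image, Set.mem_ofPred_eq, Set.mem_insert_iff,
    Set.mem_singleton_iff]
  constructor
  · rintro ⟨h1, h2⟩ b (⟨i, hi, rfl⟩ | rfl | rfl)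
    · exact h1 i hi
    · exact h2.le
    · rw [inner_neg_left, h2, neg_zero]
  · intro H
    refine ⟨fun i hi => H _ (Or.inl ⟨i, hi, rfl⟩), le_antisymm (H y (by simp)) ?_⟩
    have := H (-y) (by simp)
    rw [inner_neg_left] at this
    linarith

/-- The normals of the critical cone of `polyCone S` at `h` for `y`. -/
def critNormals (S : Set E) (h y : E) : Set E :=
  {a ∈ S | ⟪a, h⟫ = 0} ∪ {y, -y}

theorem finite_critNormals {S : Set E} (hS : S.Finite) (h y : E) : (critNormals S h y).Finite :=
  (hS.subset (Set.sep_subset _ _)).union (by simp)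

theorem criticalCone_polyCone {S : Set E} (hS : S.Finite) {h : E} (y : E) (hh : h ∈ polyCone S) :
    criticalCone (polyCone S) h y = polyCone (critNormals S h y) := by
  have : Finite S := hS
  rw [polyCone_eq_polyhedron] at hh
  rw [polyCone_eq_polyhedron S, criticalCone_polyhedron y hh, critNormals]
  congr 2
  ext b
  simp [and_comm]

theorem mem_polyCone_critNormals {S : Set E} {h y w : E} :
    w ∈ polyCone (critNormals S h y) ↔ (∀ a ∈ S, ⟪a, h⟫ = 0 → ⟪a, w⟫ ≤ 0) ∧ ⟪y, w⟫ = 0 := by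
  constructor
  · intro H
    refine ⟨fun a ha h0 => H a (Or.inl ⟨ha, h0⟩),
      le_antisymm (H y (by simp [critNormals])) ?_⟩
    have := H (-y) (by simp [critNormals])
    rw [inner_neg_left] at this
    linarith
  · rintro ⟨h1, h2⟩ b (⟨hb, h0⟩ | rfl | rfl)
    · exact h1 b hb h0
    · exact h2.le
    · rw [inner_neg_left, h2, neg_zero]

/-- The normal cone of a polyhedron depends only on the active constraints. -/
theorem mem_normalCone_polyhedron_iff {ι : Type*} [Finite ι] {a : ι → E} {α : ι → ℝ} {h y : E}
    (hh : h ∈ polyhedron a α) :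
    y ∈ normalCone (polyhedron a α) h ↔
      ∀ w, (∀ i, ⟪a i, h⟫ = α i → ⟪a i, w⟫ ≤ 0) → ⟪y, w⟫ ≤ 0 := by
  constructor
  · intro hy w hw
    obtain ⟨t, ht, ht0⟩ := (((eventually_add_smul_mem_polyhedron hh hw).filter_mono
      (nhdsWithin_mono _ Set.Ioi_subset_Ici_self)).and self_mem_nhdsWithin).exists
    have := hy.2 _ ht
    rw [add_sub_cancel_left, inner_smul_right] at this
    exact nonpos_of_mul_nonpos_right this ht0
  · intro H
    refine ⟨hh, fun u hu => H _ fun i hi => ?_⟩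
    rw [inner_sub_right, hi]
    linarith [hu i]

variable [FiniteDimensional ℝ E]

/-- The polyhedral reduction: near `x`, the projection onto a polyhedron is the translated
projection onto the critical cone. -/
theorem eventually_proj_add {ι : Type*} [Finite ι] {a : ι → E} {α : ι → ℝ}
    (hne : (polyhedron a α).Nonempty) (x : E) :
    ∀ᶠ u in 𝓝 (0 : E), proj (polyhedron a α) (x + u) = proj (polyhedron a α) x +
      proj (criticalCone (polyhedron a α) (proj (polyhedron a α) x)
        (x - proj (polyhedron a α) x)) u := by
  set C := polyhedron a α with hCdef
  have hcl : IsClosed C := isClosed_polyhedron a α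
  have hcv : Convex ℝ C := convex_polyhedron a α
  set P := proj C with hP
  have hPc : Continuous P := continuous_proj hne hcl hcv
  set h := P x with hh
  set y := x - h with hy
  have hyN : y ∈ normalCone C h := sub_proj_mem hne hcl hcv x
  let T : Set ι → Set E := fun I => {w | ∀ i ∈ I, ⟪a i, w⟫ ≤ 0}
  let N : Set ι → Set E := fun I => {v | ∀ w ∈ T I, ⟪v, w⟫ ≤ 0}
  have hNcl : ∀ I, IsClosed (N I) := fun I => by
    have : N I = ⋂ w ∈ T I, {v | ⟪v, w⟫ ≤ 0} := by ext; simp [N]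
    rw [this]
    exact isClosed_biInter fun w _ => isClosed_le (by fun_prop) continuous_const
  let act : E → Set ι := fun k => {i | ⟪a i, k⟫ = α i}
  have hNact : ∀ k ∈ C, ∀ v, v ∈ normalCone C k ↔ v ∈ N (act k) := fun k hk v => by
    rw [hCdef, mem_normalCone_polyhedron_iff hk]; rfl
  have hcont : Filter.Tendsto (fun u : E => P (x + u)) (𝓝 0) (𝓝 h) := by
    have : ContinuousAt (fun u : E => P (x + u)) 0 := by fun_prop
    simpa [ContinuousAt] using this
  have hconty : Filter.Tendsto (fun u : E => x + u - P (x + u)) (𝓝 0) (𝓝 y) := by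
    have : ContinuousAt (fun u : E => x + u - P (x + u)) 0 := by fun_prop
    simpa [ContinuousAt] using this
  -- There are finitely many cones `N I`, all closed, so a normal close to y lies only in those that
  -- contain y.
  have hstay : ∀ᶠ u in 𝓝 (0 : E), ∀ I : Set ι, x + u - P (x + u) ∈ N I → y ∈ N I := by
    refine Filter.eventually_all.2 fun I => ?_
    by_cases hI : y ∈ N I
    · exact Filter.Eventually.of_forall fun _ _ => hI
    · exact (hconty.eventually ((hNcl I).isOpen_compl.mem_nhds hI)).mono fun u hu h' => absurd h' hu
  have hact : ∀ᶠ u in 𝓝 (0 : E), act (P (x + u)) ⊆ act h := by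
    have : ∀ i, ∀ᶠ u in 𝓝 (0 : E), ⟪a i, P (x + u)⟫ = α i → ⟪a i, h⟫ = α i := fun i => by
      by_cases hi : ⟪a i, h⟫ = α i
      · exact Filter.Eventually.of_forall fun _ _ => hi
      · have : Filter.Tendsto (fun u : E => ⟪a i, P (x + u)⟫) (𝓝 0) (𝓝 ⟪a i, h⟫) :=
          tendsto_const_nhds.inner hcont
        exact (this.eventually_ne hi).mono fun u hu h' => absurd h' hu
    exact (Filter.eventually_all.2 this).mono fun u hu i hi => hu i hi
  filter_upwards [hstay, hact] with u hu hIu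
  set h' := P (x + u) with hh'
  have hy'N : x + u - h' ∈ normalCone C h' := sub_proj_mem hne hcl hcv (x + u)
  -- The old normal y is also normal at the new point h'. This forces h' − h to be orthogonal to y,
  -- hence critical.
  have hyN' : y ∈ normalCone C h' := (hNact h' hy'N.1 y).2 (hu _ ((hNact h' hy'N.1 _).1 hy'N))
  have horth : ⟪y, h' - h⟫ = 0 := by
    have h1 := hyN.2 h' hy'N.1
    have h2 := hyN'.2 h hyN.1
    rw [inner_sub_right] at *
    linarith
  have key : proj (criticalCone C h y) u = h' - h := by
    apply proj_eq_of_mem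
    have e : u - (h' - h) = (x + u - h') - y := by rw [hy]; abel
    have hmem : ∀ w, w ∈ criticalCone C h y ↔ (∀ i, ⟪a i, h⟫ = α i → ⟪a i, w⟫ ≤ 0) ∧ ⟪y, w⟫ = 0 :=
      fun w => mem_criticalCone_polyhedron hyN.1
    refine ⟨(hmem _).2 ⟨fun i hi => ?_, horth⟩, fun k hk => ?_⟩
    · rw [inner_sub_right, hi]; linarith [hy'N.1 i]
    · rw [hmem] at hk
      rw [e, inner_sub_left]
      have h3 : ⟪x + u - h', k - (h' - h)⟫ ≤ 0 := by
        refine (mem_normalCone_polyhedron_iff hy'N.1).1 hy'N _ fun i hi => ?_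
        have hi' : ⟪a i, h⟫ = α i := hIu hi
        have := hk.1 i hi'
        rw [inner_sub_right, inner_sub_right, hi, hi']
        linarith
      have h4 : ⟪y, k - (h' - h)⟫ = 0 := by rw [inner_sub_right, hk.2, horth, sub_zero]
      linarith
  rw [key]; abel

end Polyhedron

/-! ### Openness at a linear rate: localization, homogeneity, descent criterion -/

section LinearOpenness

variable {E : Type*} [NormedAddCommGroup E]

/-- `f` is open at a linear rate, uniformly over the whole space. -/
def LinearlyOpen (f : E → E) : Prop :=
  ∃ κ : ℝ, 0 < κ ∧ ∀ x z, ∃ x', f x' = z ∧ ‖x' - x‖ ≤ κ * ‖z - f x‖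

/-- `f` is open at a linear rate near `x₀`. -/
def LinearlyOpenNear (f : E → E) (x₀ : E) : Prop :=
  ∃ κ : ℝ, 0 < κ ∧ ∀ᶠ p : E × E in 𝓝 (x₀, f x₀),
    ∃ x', f x' = p.2 ∧ ‖x' - p.1‖ ≤ κ * ‖p.2 - f p.1‖

theorem LinearlyOpen.surjective {f : E → E} (h : LinearlyOpen f) : Function.Surjective f := by
  obtain ⟨κ, -, H⟩ := h
  intro z
  obtain ⟨x, hx, -⟩ := H 0 z
  exact ⟨x, hx⟩

theorem LinearlyOpen.near {f : E → E} (h : LinearlyOpen f) (x₀ : E) : LinearlyOpenNear f x₀ := by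
  obtain ⟨κ, hκ, H⟩ := h
  exact ⟨κ, hκ, Filter.Eventually.of_forall fun p => H p.1 p.2⟩

theorem LinearlyOpen.isOpenMap {f : E → E} (h : LinearlyOpen f) : IsOpenMap f := by
  obtain ⟨κ, hκ, H⟩ := h
  intro U hU
  rw [Metric.isOpen_iff] at hU ⊢
  rintro _ ⟨x, hx, rfl⟩
  obtain ⟨ε, hε, hball⟩ := hU x hx
  refine ⟨ε / κ, by positivity, fun z hz => ?_⟩
  obtain ⟨x', hx', hle⟩ := H x z
  refine ⟨x', hball ?_, hx'⟩
  rw [mem_ball_iff_norm] at hz ⊢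
  calc ‖x' - x‖ ≤ κ * ‖z - f x‖ := hle
    _ < κ * (ε / κ) := by gcongr
    _ = ε := by field_simp

/-- Linear openness passes to the germ of `f` at `x₀`. -/
theorem LinearlyOpenNear.of_eventually_eq {f g : E → E} {x₀ : E} (hf : Continuous f)
    (h : LinearlyOpenNear f x₀) (hfg : ∀ᶠ u in 𝓝 (0 : E), f (x₀ + u) = f x₀ + g u) :
    LinearlyOpenNear g 0 := by
  obtain ⟨κ, hκ, H⟩ := h
  have hg0 : g 0 = 0 := by simpa using hfg.self_of_nhds
  refine ⟨κ, hκ, ?_⟩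
  rw [hg0]
  have t1 : Filter.Tendsto (fun p : E × E => (x₀ + p.1, f x₀ + p.2)) (𝓝 (0, 0)) (𝓝 (x₀, f x₀)) := by
    have : ContinuousAt (fun p : E × E => (x₀ + p.1, f x₀ + p.2)) (0, 0) := by fun_prop
    simpa [ContinuousAt] using this
  have t2 : Filter.Tendsto (fun p : E × E => p.1) (𝓝 (0, 0)) (𝓝 (0 : E)) :=
    Continuous.tendsto' continuous_fst _ _ rfl
  obtain ⟨ε, hε, hball⟩ := Metric.eventually_nhds_iff.1 hfg
  -- The preimage x' must itself stay in the ball where the local formula holds; this quantity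
  -- bounds its distance to x₀.
  have t3 : ∀ᶠ p : E × E in 𝓝 (0, 0),
      ‖p.1‖ + κ * ‖f x₀ + p.2 - f (x₀ + p.1)‖ < ε := by
    have : ContinuousAt (fun p : E × E => ‖p.1‖ + κ * ‖f x₀ + p.2 - f (x₀ + p.1)‖) (0, 0) := by
      fun_prop
    exact this.eventually_lt continuousAt_const (by simpa using hε)
  filter_upwards [t1.eventually H, t2.eventually hfg, t3] with p hp hp1 hp3
  obtain ⟨x', hx', hle⟩ := hp
  have hsmall : ‖x' - x₀‖ < ε := by
    calc ‖x' - x₀‖ = ‖(x' - (x₀ + p.1)) + p.1‖ := by congr 1; abel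
      _ ≤ ‖x' - (x₀ + p.1)‖ + ‖p.1‖ := norm_add_le _ _
      _ < ε := by linarith
  have h2 := hball (y := x' - x₀) (by simpa [dist_eq_norm] using hsmall)
  rw [add_sub_cancel, hx'] at h2
  refine ⟨x' - x₀, (add_left_cancel h2).symm, ?_⟩
  rw [hp1] at hle
  have e1 : x' - x₀ - p.1 = x' - (x₀ + p.1) := by abel
  have e2 : p.2 - g p.1 = f x₀ + p.2 - (f x₀ + g p.1) := by abel
  rw [e1, e2]
  exact hle

variable [NormedSpace ℝ E]

/-- Any pair (x, z) can be scaled by a small t > 0 into the neighborhood, solved there and scaled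
back; the rate is unchanged. -/
theorem LinearlyOpenNear.linearlyOpen {g : E → E} (h : LinearlyOpenNear g 0)
    (hg : ∀ (t : ℝ) (x : E), 0 ≤ t → g (t • x) = t • g x) : LinearlyOpen g := by
  obtain ⟨κ, hκ, H⟩ := h
  have hg0 : g 0 = 0 := by simpa using hg 0 0 le_rfl
  rw [hg0] at H
  refine ⟨κ, hκ, fun x z => ?_⟩
  have t1 : Filter.Tendsto (fun t : ℝ => (t • x, t • z)) (𝓝[>] 0) (𝓝 (0, 0)) := by
    have : ContinuousAt (fun t : ℝ => (t • x, t • z)) 0 := by fun_prop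
    simpa [ContinuousAt] using this.tendsto.mono_left nhdsWithin_le_nhds
  obtain ⟨t, ⟨x', hx', hle⟩, ht⟩ := ((t1.eventually H).and self_mem_nhdsWithin).exists
  have ht0 : 0 < t := ht
  dsimp only at hx' hle
  refine ⟨t⁻¹ • x', ?_, ?_⟩
  · rw [hg _ _ (by positivity), hx', inv_smul_smul₀ ht0.ne']
  · rw [hg _ _ ht0.le, ← smul_sub, norm_smul, Real.norm_of_nonneg ht0.le] at hle
    have e : t⁻¹ • x' - x = t⁻¹ • (x' - t • x) := by rw [smul_sub, inv_smul_smul₀ ht0.ne']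
    rw [e, norm_smul, norm_inv, Real.norm_of_nonneg ht0.le, inv_mul_le_iff₀ ht0]
    linarith

/-- A uniform rate of decrease of `‖f - z‖` gives linear openness. -/
theorem linearlyOpen_of_decrease [FiniteDimensional ℝ E] {f : E → E} (hf : Continuous f) {c : ℝ}
    (hc : 0 < c) (H : ∀ x z, f x ≠ z → ∃ u, ‖f u - z‖ + c * ‖u - x‖ < ‖f x - z‖) :
    LinearlyOpen f := by
  refine ⟨c⁻¹, by positivity, fun x z => ?_⟩
  have : ProperSpace E := FiniteDimensional.proper ℝ E
  set φ : E → ℝ := fun u => ‖f u - z‖ + c * ‖u - x‖ with hφ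
  have hφc : Continuous φ := by fun_prop
  -- As in Ekeland's principle, but with the minimum attained: φ is coercive, and at a minimizer v
  -- with f v ≠ z the decrease hypothesis and the triangle inequality would lower φ further.
  obtain ⟨v, hv⟩ : ∃ v, ∀ u, φ v ≤ φ u := by
    refine hφc.exists_forall_le' x ?_
    have : ∀ᶠ u in Filter.cocompact E, c⁻¹ * φ x + ‖x‖ ≤ ‖u‖ :=
      (tendsto_norm_cocompact_atTop (E := E)).eventually_ge_atTop _
    filter_upwards [this] with u hu
    have h1 : ‖u‖ ≤ ‖u - x‖ + ‖x‖ := by simpa using norm_add_le (u - x) x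
    have h2 : c⁻¹ * φ x ≤ ‖u - x‖ := by linarith
    rw [inv_mul_le_iff₀ hc] at h2
    have := norm_nonneg (f u - z)
    change φ x ≤ ‖f u - z‖ + c * ‖u - x‖
    linarith
  have hvz : f v = z := by
    by_contra hne
    obtain ⟨u, hu⟩ := H v z hne
    have h1 : ‖u - x‖ ≤ ‖u - v‖ + ‖v - x‖ := norm_sub_le_norm_sub_add_norm_sub _ _ _
    have h2 : ‖f v - z‖ + c * ‖v - x‖ ≤ ‖f u - z‖ + c * ‖u - x‖ := hv u
    nlinarith
  refine ⟨v, hvz, ?_⟩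
  have h2 : ‖f v - z‖ + c * ‖v - x‖ ≤ ‖f x - z‖ + c * ‖x - x‖ := hv x
  rw [hvz, sub_self, norm_zero, zero_add, sub_self, norm_zero, mul_zero, add_zero,
    norm_sub_rev (f x)] at h2
  rw [le_inv_mul_iff₀ hc]
  exact h2

end LinearOpenness

/-! ### Normal maps of polyhedral cones and the nondegeneracy criterion for openness -/

section NormalMap

variable {E : Type*} [NormedAddCommGroup E] [InnerProductSpace ℝ E]

/-- The normal map of Robinson associated with `A` and `C`. -/
noncomputable def normalMap (A : E →ₗ[ℝ] E) (C : Set E) (x : E) : E :=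
  A (proj C x) + (x - proj C x)

theorem normalMap_add_of_mem (A : E →ₗ[ℝ] E) {C : Set E} {h y : E} (hy : y ∈ normalCone C h) :
    normalMap A C (h + y) = A h + y := by
  rw [normalMap, proj_add_of_mem hy, add_sub_cancel_left]

/-- The normals of the critical cone of `polyCone S` at the pair represented by `x`. -/
noncomputable def critNormalsAt (S : Set E) (x : E) : Set E :=
  critNormals S (proj (polyCone S) x) (x - proj (polyCone S) x)

theorem critNormalsAt_add {S : Set E} {h y : E} (hy : y ∈ normalCone (polyCone S) h) :
    critNormalsAt S (h + y) = critNormals S h y := by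
  rw [critNormalsAt, proj_add_of_mem hy, add_sub_cancel_left]

/-- A convex subset of a polyhedral cone contains a point with the fewest active constraints. -/
theorem exists_minimal_active {S F : Set E} (hS : S.Finite) (hF : F ⊆ polyCone S)
    (hne : F.Nonempty) (hcv : Convex ℝ F) :
    ∃ h ∈ F, ∀ x ∈ F, ∀ a ∈ S, ⟪a, h⟫ = 0 → ⟪a, x⟫ = 0 := by
  let J : E → Set E := fun k => {a ∈ S | ⟪a, k⟫ = 0}
  have hfin : (J '' F).Finite :=
    hS.finite_subsets.subset (by rintro _ ⟨k, -, rfl⟩; exact Set.sep_subset _ _)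
  obtain ⟨B, hB⟩ := hfin.exists_minimal (hne.image J)
  obtain ⟨k, hk, rfl⟩ := hB.prop
  refine ⟨k, hk, fun w hw a ha ha0 => ?_⟩
  set m := (1 / 2 : ℝ) • k + (1 / 2 : ℝ) • w with hm
  have hsub : ∀ b ∈ J m, ⟪b, k⟫ = 0 ∧ ⟪b, w⟫ = 0 := by
    rintro b ⟨hb, hb0⟩
    rw [hm, inner_add_right, inner_smul_right, inner_smul_right] at hb0
    have h1 := hF hk b hb
    have h2 := hF hw b hb
    constructor <;> linarith
  have hmF : m ∈ F := hcv hk hw (by norm_num) (by norm_num) (by norm_num)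
  have := hB.le_of_le ⟨m, hmF, rfl⟩ fun b hb => ⟨hb.1, (hsub b hb).1⟩
  exact (hsub a (this ⟨ha, ha0⟩)).2

/-- The critical cones of a polyhedral cone form a finite family. -/
theorem finite_polyCone_critNormals {S : Set E} (hS : S.Finite) :
    {K | ∃ h y, y ∈ normalCone (polyCone S) h ∧ K = polyCone (critNormals S h y)}.Finite := by
  let Ψ : Set E × Set E → Set E := fun p => {w | (∀ a ∈ p.1, ⟪a, w⟫ ≤ 0) ∧ ∀ a ∈ p.2, ⟪a, w⟫ = 0}
  refine ((hS.finite_subsets.prod hS.finite_subsets).image Ψ).subset ?_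
  rintro _ ⟨h, y, hy, rfl⟩
  obtain ⟨hh, hyK, h0⟩ := mem_normalCone_polyCone.1 hy
  set K := polyCone (critNormals S h y) with hK
  have hmem : ∀ w, w ∈ K ↔ (∀ a ∈ S, ⟪a, h⟫ = 0 → ⟪a, w⟫ ≤ 0) ∧ ⟪y, w⟫ = 0 :=
    fun w => mem_polyCone_critNormals
  let I : Set E := {a ∈ S | ⟪a, h⟫ = 0}
  have hI : I.Finite := hS.subset (Set.sep_subset _ _)
  -- K is recovered from two subsets of S: the normals I active at h, and the normals J in I that
  -- vanish on all of K, read off at a point k of K with the fewest active constraints.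
  obtain ⟨k, hk, hmin⟩ := exists_minimal_active hI
    (fun w hw a ha => ((hmem w).1 hw).1 a ha.1 ha.2) (nonempty_polyCone _) (convex_polyCone _)
  let J : Set E := {a ∈ I | ⟪a, k⟫ = 0}
  refine ⟨(I, J), ⟨Set.sep_subset _ _, (Set.sep_subset _ _).trans (Set.sep_subset _ _)⟩, ?_⟩
  ext w
  constructor
  · rintro ⟨hw1, hw2⟩
    refine (hmem w).2 ⟨fun a ha ha0 => hw1 a ⟨ha, ha0⟩, ?_⟩
    have : Finite S := hS
    have hyT : ∀ v, (∀ a ∈ S, ⟪a, h⟫ = 0 → ⟪a, v⟫ ≤ 0) → ⟪y, v⟫ ≤ 0 := by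
      rw [polyCone_eq_polyhedron] at hy hh
      have := (mem_normalCone_polyhedron_iff hh).1 hy
      intro v hv
      exact this v fun i hi => hv i i.2 hi
    refine le_antisymm (hyT w fun a ha ha0 => hw1 a ⟨ha, ha0⟩) ?_
    -- Since w vanishes on J, k − t w satisfies the constraints of I for small t > 0. There y is
    -- nonpositive, while ⟪y, k⟫ = 0, so ⟪y, w⟫ ≥ 0.
    have : Finite I := hI
    have hkI : k ∈ polyhedron (fun a : I => (a : E)) 0 := fun a =>
      ((hmem k).1 hk).1 a a.2.1 a.2.2
    obtain ⟨t, ht, ht0⟩ := (((eventually_add_smul_mem_polyhedron (w := -w) hkI fun a ha => by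
      rw [inner_neg_right, hw2 a ⟨a.2, ha⟩, neg_zero]).filter_mono
      (nhdsWithin_mono _ Set.Ioi_subset_Ici_self)).and self_mem_nhdsWithin).exists
    have := hyT (k + t • -w) fun a ha ha0 => ht ⟨a, ha, ha0⟩
    rw [inner_add_right, ((hmem k).1 hk).2, inner_smul_right, inner_neg_right] at this
    have ht0' : 0 < t := ht0
    by_contra! hlt
    nlinarith
  · intro hw
    exact ⟨fun a ha => ((hmem w).1 hw).1 a ha.1 ha.2, fun a ha => hmin w hw a ha.1 ha.2⟩

variable [FiniteDimensional ℝ E]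

theorem continuous_normalMap (A : E →ₗ[ℝ] E) {C : Set E} (hne : C.Nonempty) (hcl : IsClosed C)
    (hcv : Convex ℝ C) : Continuous (normalMap A C) := by
  have h1 := continuous_proj hne hcl hcv
  have h2 : Continuous A := A.continuous_of_finiteDimensional
  exact (h2.comp h1).add (continuous_id.sub h1)

theorem continuous_normalMap_polyCone (A : E →ₗ[ℝ] E) (S : Set E) :
    Continuous (normalMap A (polyCone S)) :=
  continuous_normalMap A (nonempty_polyCone S) (isClosed_polyCone S) (convex_polyCone S)

theorem sub_proj_polyCone_mem (S : Set E) (x : E) :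
    x - proj (polyCone S) x ∈ normalCone (polyCone S) (proj (polyCone S) x) :=
  sub_proj_mem (nonempty_polyCone S) (isClosed_polyCone S) (convex_polyCone S) x

theorem proj_polyCone_smul (S : Set E) {t : ℝ} (ht : 0 ≤ t) (x : E) :
    proj (polyCone S) (t • x) = t • proj (polyCone S) x := by
  obtain ⟨h1, h2, h3⟩ := mem_normalCone_polyCone.1 (sub_proj_polyCone_mem S x)
  apply proj_eq_of_mem
  rw [← smul_sub]
  refine mem_normalCone_polyCone.2 ⟨smul_mem_polyCone h1 ht, fun k hk => ?_, ?_⟩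
  · rw [real_inner_smul_left]
    exact mul_nonpos_of_nonneg_of_nonpos ht (h2 k hk)
  · rw [real_inner_smul_left, inner_smul_right, h3, mul_zero, mul_zero]

theorem normalMap_polyCone_smul (A : E →ₗ[ℝ] E) (S : Set E) (t : ℝ) (x : E) (ht : 0 ≤ t) :
    normalMap A (polyCone S) (t • x) = t • normalMap A (polyCone S) x := by
  simp only [normalMap, proj_polyCone_smul S ht, map_smul, smul_add, smul_sub]

theorem eventually_normalMap_add (A : E →ₗ[ℝ] E) {ι : Type*} [Finite ι] {a : ι → E} {α : ι → ℝ}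
    (hne : (polyhedron a α).Nonempty) (x : E) :
    ∀ᶠ u in 𝓝 (0 : E), normalMap A (polyhedron a α) (x + u) = normalMap A (polyhedron a α) x +
      normalMap A (criticalCone (polyhedron a α) (proj (polyhedron a α) x)
        (x - proj (polyhedron a α) x)) u := by
  filter_upwards [eventually_proj_add hne x] with u hu
  simp only [normalMap, hu, map_add]
  abel

theorem eventually_normalMap_polyCone_add (A : E →ₗ[ℝ] E) {S : Set E} (hS : S.Finite) (x : E) :
    ∀ᶠ u in 𝓝 (0 : E), normalMap A (polyCone S) (x + u) =
      normalMap A (polyCone S) x + normalMap A (polyCone (critNormalsAt S x)) u := by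
  have : Finite S := hS
  have hne := nonempty_polyCone S
  have hmem := (sub_proj_polyCone_mem S x).1
  have := criticalCone_polyCone hS (x - proj (polyCone S) x) hmem
  rw [critNormalsAt, ← this]
  simp only [polyCone_eq_polyhedron S] at hne ⊢
  exact eventually_normalMap_add A hne x

theorem linearlyOpen_critNormalsAt {A : E →ₗ[ℝ] E} {S : Set E} (hS : S.Finite)
    (h : LinearlyOpen (normalMap A (polyCone S))) (x : E) :
    LinearlyOpen (normalMap A (polyCone (critNormalsAt S x))) :=
  ((h.near x).of_eventually_eq (continuous_normalMap_polyCone A S)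
    (eventually_normalMap_polyCone_add A hS x)).linearlyOpen
      (normalMap_polyCone_smul A (critNormalsAt S x))

/-- No critical cone `K'` of `polyCone S` contains a nonzero `z` with `A* z` in the polar of
`K'`. -/
def CritNondegenerate (A : E →ₗ[ℝ] E) (S : Set E) : Prop :=
  ∀ h y, y ∈ normalCone (polyCone S) h → ∀ z ∈ polyCone (critNormals S h y),
    (∀ w ∈ polyCone (critNormals S h y), ⟪z, A w⟫ ≤ 0) → z = 0

/-- The local model at k + y is open, hence onto. If z is its value at v, pairing z with A(P v) and
with v − P v gives two nonpositive terms, so ⟪z, z⟫ ≤ 0. -/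
theorem LinearlyOpen.critNondegenerate {A : E →ₗ[ℝ] E} {S : Set E} (hS : S.Finite)
    (h : LinearlyOpen (normalMap A (polyCone S))) : CritNondegenerate A S := by
  intro k y hy z hz hzA
  obtain ⟨v, hv⟩ := (linearlyOpen_critNormalsAt hS h (k + y)).surjective z
  rw [critNormalsAt_add hy] at hv
  obtain ⟨h1, h2, -⟩ := mem_normalCone_polyCone.1 (sub_proj_polyCone_mem (critNormals S k y) v)
  have h3 : ⟪z, normalMap A (polyCone (critNormals S k y)) v⟫ ≤ 0 := by
    rw [normalMap, inner_add_right]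
    have h4 := h2 z hz
    rw [real_inner_comm] at h4
    exact add_nonpos (hzA _ h1) h4
  rw [hv] at h3
  exact real_inner_self_nonpos.1 h3

/-- If all pairings with w were nonpositive, the value at the polar part w − P w would show w ∈ K,
and the values at points of K would then make w violate nondegeneracy. -/
theorem exists_inner_normalMap_pos {A : E →ₗ[ℝ] E} {S : Set E}
    (hA : ∀ z ∈ polyCone S, (∀ w ∈ polyCone S, ⟪z, A w⟫ ≤ 0) → z = 0) {w : E} (hw : w ≠ 0) :
    ∃ v, 0 < ⟪normalMap A (polyCone S) v, w⟫ := by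
  by_contra! H
  have hS := sub_proj_polyCone_mem S w
  obtain ⟨h1, h2, h3⟩ := mem_normalCone_polyCone.1 hS
  refine hw (hA w ?_ fun k hk => ?_)
  · have h4 : w - proj (polyCone S) w ∈ normalCone (polyCone S) 0 :=
      mem_normalCone_polyCone.2 ⟨zero_mem_polyCone S, h2, inner_zero_right _⟩
    have h5 := H (0 + (w - proj (polyCone S) w))
    rw [normalMap_add_of_mem A h4, map_zero, zero_add] at h5
    have h6 : ⟪w - proj (polyCone S) w, w - proj (polyCone S) w⟫ ≤ 0 := by
      rw [inner_sub_right, h3, sub_zero]; exact h5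
    rw [sub_eq_zero.1 (real_inner_self_nonpos.1 h6)]
    exact h1
  · have h4 : (0 : E) ∈ normalCone (polyCone S) k :=
      mem_normalCone_polyCone.2 ⟨hk, fun _ _ => (inner_zero_left _).le, inner_zero_left _⟩
    have h5 := H (k + 0)
    rwa [normalMap_add_of_mem A h4, add_zero, real_inner_comm] at h5

theorem exists_uniform_inner_normalMap {A : E →ₗ[ℝ] E} {S : Set E}
    (hA : ∀ z ∈ polyCone S, (∀ w ∈ polyCone S, ⟪z, A w⟫ ≤ 0) → z = 0) :
    ∃ c > 0, ∀ w : E, ‖w‖ = 1 → ∃ v, ‖v‖ ≤ 1 ∧ c < ⟪normalMap A (polyCone S) v, w⟫ := by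
  have : ProperSpace E := FiniteDimensional.proper ℝ E
  have key : ∃ c > 0, ∀ w ∈ Metric.sphere (0 : E) 1,
      ∃ v, ‖v‖ ≤ 1 ∧ c < ⟪normalMap A (polyCone S) v, w⟫ := by
    refine (isCompact_sphere (0 : E) 1).induction_on
      (p := fun s => ∃ c > 0, ∀ w ∈ s, ∃ v, ‖v‖ ≤ 1 ∧ c < ⟪normalMap A (polyCone S) v, w⟫)
      ⟨1, one_pos, by simp⟩ ?_ ?_ ?_
    · rintro s t hst ⟨c, hc, H⟩
      exact ⟨c, hc, fun w hw => H w (hst hw)⟩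
    · rintro s t ⟨c, hc, H⟩ ⟨d, hd, H'⟩
      refine ⟨min c d, lt_min hc hd, ?_⟩
      rintro w (hw | hw)
      · obtain ⟨v, hv, h⟩ := H w hw
        exact ⟨v, hv, (min_le_left _ _).trans_lt h⟩
      · obtain ⟨v, hv, h⟩ := H' w hw
        exact ⟨v, hv, (min_le_right _ _).trans_lt h⟩
    · intro w hw
      have hw0 : w ≠ 0 := by rintro rfl; simp at hw
      obtain ⟨v, hv⟩ := exists_inner_normalMap_pos hA hw0
      set v' := (1 + ‖v‖)⁻¹ • v with hv'
      have hpos : 0 < 1 + ‖v‖ := by positivity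
      have hv'1 : ‖v'‖ ≤ 1 := by
        rw [hv', norm_smul, norm_inv, Real.norm_of_nonneg hpos.le, inv_mul_le_iff₀ hpos]
        linarith
      have hpos' : 0 < ⟪normalMap A (polyCone S) v', w⟫ := by
        rw [hv', normalMap_polyCone_smul _ _ _ _ (by positivity), real_inner_smul_left]
        positivity
      refine ⟨{u | ⟪normalMap A (polyCone S) v', w⟫ / 2 < ⟪normalMap A (polyCone S) v', u⟫},
        mem_nhdsWithin_of_mem_nhds ?_, _, half_pos hpos', fun u hu => ⟨v', hv'1, hu⟩⟩
      exact (isOpen_lt continuous_const (by fun_prop)).mem_nhds (half_lt_self hpos')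
  obtain ⟨c, hc, H⟩ := key
  exact ⟨c, hc, fun w hw => H w (by simpa using hw)⟩

/-- The local model at x is the one-sided derivative of f there. It has a direction v of norm at
most 1 whose image makes a definite positive product with the unit vector towards z. As there are
finitely many critical cones, the bound c is uniform in x. -/
theorem CritNondegenerate.linearlyOpen {A : E →ₗ[ℝ] E} {S : Set E} (hS : S.Finite)
    (h : CritNondegenerate A S) : LinearlyOpen (normalMap A (polyCone S)) := by
  have key : ∀ᶠ c : ℝ in 𝓝[>] 0, ∀ x w : E, ‖w‖ = 1 →
      ∃ v, ‖v‖ ≤ 1 ∧ c < ⟪normalMap A (polyCone (critNormalsAt S x)) v, w⟫ := by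
    have h1 : ∀ᶠ c : ℝ in 𝓝[>] 0,
        ∀ K ∈ {K | ∃ h y, y ∈ normalCone (polyCone S) h ∧ K = polyCone (critNormals S h y)},
        ∀ w : E, ‖w‖ = 1 → ∃ v, ‖v‖ ≤ 1 ∧ c < ⟪normalMap A K v, w⟫ := by
      rw [Filter.eventually_all_finite (finite_polyCone_critNormals hS)]
      rintro _ ⟨k, y, hy, rfl⟩
      obtain ⟨c, hc, H⟩ := exists_uniform_inner_normalMap (h k y hy)
      filter_upwards [Ioo_mem_nhdsGT hc] with d hd w hw
      obtain ⟨v, hv, hlt⟩ := H w hw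
      exact ⟨v, hv, hd.2.trans hlt⟩
    filter_upwards [h1] with c hc x
    exact hc _ ⟨_, _, sub_proj_polyCone_mem S x, rfl⟩
  obtain ⟨c, H, hc0⟩ := (key.and self_mem_nhdsWithin).exists
  have hc : 0 < c := hc0
  refine linearlyOpen_of_decrease (continuous_normalMap_polyCone A S) (half_pos hc)
    fun x z hxz => ?_
  set f := normalMap A (polyCone S) with hf
  set r := ‖f x - z‖ with hr
  have hr0 : 0 < r := norm_pos_iff.2 (sub_ne_zero.2 hxz)
  set w := r⁻¹ • (z - f x) with hw
  have hw1 : ‖w‖ = 1 := by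
    rw [hw, norm_smul, norm_inv, Real.norm_of_nonneg hr0.le, norm_sub_rev, ← hr,
      inv_mul_cancel₀ hr0.ne']
  obtain ⟨v, hv1, hv⟩ := H x w hw1
  set d := normalMap A (polyCone (critNormalsAt S x)) v with hd
  have hzf : z - f x = r • w := by rw [hw, smul_inv_smul₀ hr0.ne']
  have e1 : ∀ᶠ t : ℝ in 𝓝[>] 0, f (x + t • v) = f x + t • d := by
    have ht : Filter.Tendsto (fun t : ℝ => t • v) (𝓝[>] 0) (𝓝 0) := by
      have : ContinuousAt (fun t : ℝ => t • v) 0 := by fun_prop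
      simpa [ContinuousAt] using this.tendsto.mono_left nhdsWithin_le_nhds
    filter_upwards [ht.eventually (eventually_normalMap_polyCone_add A hS x),
      self_mem_nhdsWithin] with t h1 h2
    rw [hf, h1, normalMap_polyCone_smul _ _ _ _ (le_of_lt h2)]
  -- This lets the quadratic term use up at most half of the first-order gain 2trc, leaving descent
  -- at rate c/2.
  have e2 : ∀ᶠ t : ℝ in 𝓝[>] 0, t * ‖d‖ ^ 2 < r * c := by
    have ht : ContinuousAt (fun t : ℝ => t * ‖d‖ ^ 2) 0 := by fun_prop
    exact (ht.eventually_lt continuousAt_const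
      (by rw [zero_mul]; positivity)).filter_mono nhdsWithin_le_nhds
  have e3 : ∀ᶠ t : ℝ in 𝓝[>] 0, t * c < r := by
    have ht : ContinuousAt (fun t : ℝ => t * c) 0 := by fun_prop
    exact (ht.eventually_lt continuousAt_const
      (by rw [zero_mul]; positivity)).filter_mono nhdsWithin_le_nhds
  obtain ⟨t, ⟨⟨h1, h2⟩, h3⟩, ht⟩ := (((e1.and e2).and e3).and self_mem_nhdsWithin).exists
  have ht0 : 0 < t := ht
  refine ⟨x + t • v, ?_⟩
  have h4 : ‖f (x + t • v) - z‖ < r - t * c / 2 := by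
    have e : f (x + t • v) - z = t • d - r • w := by rw [h1, ← hzf]; abel
    have hsq : ‖f (x + t • v) - z‖ ^ 2 = t ^ 2 * ‖d‖ ^ 2 - 2 * (t * r * ⟪d, w⟫) + r ^ 2 := by
      rw [e, norm_sub_sq_real, norm_smul, norm_smul, hw1, real_inner_smul_left, inner_smul_right,
        Real.norm_of_nonneg ht0.le, Real.norm_of_nonneg hr0.le]
      ring
    have hpos : 0 < r - t * c / 2 := by nlinarith
    refine lt_of_pow_lt_pow_left₀ 2 hpos.le ?_
    rw [hsq]
    have a1 : t * (t * ‖d‖ ^ 2) < t * (r * c) := by gcongr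
    have a2 : (t * r) * c < (t * r) * ⟪d, w⟫ := by gcongr
    have a3 : 0 < (t * c) ^ 2 := by positivity
    linear_combination a1 + 2 * a2 + a3 / 4
  have h5 : ‖x + t • v - x‖ ≤ t := by
    rw [add_sub_cancel_left, norm_smul, Real.norm_of_nonneg ht0.le]
    exact mul_le_of_le_one_right ht0.le hv1
  have h6 : c / 2 * ‖x + t • v - x‖ ≤ c / 2 * t := by gcongr
  linarith

end NormalMap

/-! ### Faces of polyhedral cones and the critical face condition -/

section CriticalFaces

variable {E : Type*} [NormedAddCommGroup E] [InnerProductSpace ℝ E]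

theorem isFace_polyCone {S N : Set E} (hN : ∀ b ∈ N, ∀ k ∈ polyCone S, ⟪b, k⟫ ≤ 0) :
    IsFace (polyCone S) {x ∈ polyCone S | ∀ b ∈ N, ⟪b, x⟫ = 0} := by
  refine ⟨⟨0, zero_mem_polyCone S, fun b _ => inner_zero_right b⟩, ?_, ?_, ?_⟩
  · have : {x ∈ polyCone S | ∀ b ∈ N, ⟪b, x⟫ = 0} = polyCone S ∩ ⋂ b ∈ N, {x | ⟪b, x⟫ = 0} := by
      ext; simp
    rw [this]
    exact (isClosed_polyCone S).inter
      (isClosed_biInter fun b _ => isClosed_eq (by fun_prop) continuous_const)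
  · rintro x ⟨hx, hx0⟩ u ⟨hu, hu0⟩ s t hs ht hst
    refine ⟨convex_polyCone S hx hu hs ht hst, fun b hb => ?_⟩
    rw [inner_add_right, inner_smul_right, inner_smul_right, hx0 b hb, hu0 b hb]
    simp
  · refine ⟨Set.sep_subset _ _, ?_⟩
    rintro x hx u hu _ ⟨-, hz⟩ ⟨s, t, hs, ht, -, rfl⟩
    refine ⟨hx, fun b hb => ?_⟩
    have h := hz b hb
    rw [inner_add_right, inner_smul_right, inner_smul_right] at h
    have h1 := hN b hb x hx
    have h2 := hN b hb u hu
    by_contra hne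
    have h3 : ⟪b, x⟫ < 0 := lt_of_le_of_ne h1 hne
    nlinarith

/-- A direction satisfying the constraints active at `h` points into the polyhedral cone. -/
theorem exists_pos_add_smul_mem_polyCone {S : Set E} (hS : S.Finite) {h w : E}
    (hh : h ∈ polyCone S) (hw : ∀ a ∈ S, ⟪a, h⟫ = 0 → ⟪a, w⟫ ≤ 0) :
    ∃ t : ℝ, 0 < t ∧ h + t • w ∈ polyCone S := by
  have : Finite S := hS
  simp only [polyCone_eq_polyhedron] at hh ⊢
  obtain ⟨t, ht, ht0⟩ := (((eventually_add_smul_mem_polyhedron hh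
    (fun i hi => hw i i.2 hi)).filter_mono
    (nhdsWithin_mono _ Set.Ioi_subset_Ici_self)).and self_mem_nhdsWithin).exists
  exact ⟨t, ht0, ht⟩

/-- Constraints active at h vanish on all of F₁, so subtracting F₁ does not affect them. Conversely,
a critical direction w satisfies h + t w ∈ F₂ for some t > 0. -/
theorem coneOf_sub_eq {S F₁ F₂ : Set E} (hS : S.Finite) {h y : E}
    (hF₂ : F₂ = {x ∈ polyCone S | ⟪y, x⟫ = 0}) (hF : F₁ ⊆ F₂) (hh : h ∈ F₁)
    (hmin : ∀ x ∈ F₁, ∀ a ∈ S, ⟪a, h⟫ = 0 → ⟪a, x⟫ = 0) :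
    coneOf (F₂ - F₁) = polyCone (critNormals S h y) := by
  ext w
  rw [mem_polyCone_critNormals]
  constructor
  · rintro ⟨t, ht, _, ⟨f₂, hf₂, f₁, hf₁, rfl⟩, rfl⟩
    have hf₁' := hF hf₁
    rw [hF₂] at hf₁' hf₂
    refine ⟨fun a ha ha0 => ?_, ?_⟩
    · rw [inner_smul_right, inner_sub_right, hmin f₁ hf₁ a ha ha0, sub_zero]
      exact mul_nonpos_of_nonneg_of_nonpos ht (hf₂.1 a ha)
    · rw [inner_smul_right, inner_sub_right, hf₂.2, hf₁'.2, sub_zero, mul_zero]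
  · rintro ⟨hw, hyw⟩
    have hh2 := hF hh
    rw [hF₂] at hh2
    obtain ⟨t, ht, htw⟩ := exists_pos_add_smul_mem_polyCone hS hh2.1 hw
    refine ⟨t⁻¹, by positivity, h + t • w - h, ⟨h + t • w, ?_, h, hh, rfl⟩, ?_⟩
    · rw [hF₂]
      refine ⟨htw, ?_⟩
      rw [inner_add_right, inner_smul_right, hyw, hh2.2, mul_zero, add_zero]
    · rw [add_sub_cancel_left, inv_smul_smul₀ ht.ne']

/-- Faces of a polyhedral cone are exposed. -/
theorem IsFace.exists_eq {S F : Set E} (hS : S.Finite) (hF : IsFace (polyCone S) F) :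
    ∃ y, (∀ k ∈ polyCone S, ⟪y, k⟫ ≤ 0) ∧ F = {x ∈ polyCone S | ⟪y, x⟫ = 0} := by
  obtain ⟨hne, -, hcv, hsub, hext⟩ := hF
  obtain ⟨h, hh, hmin⟩ := exists_minimal_active hS hsub hne hcv
  have hI : {a ∈ S | ⟪a, h⟫ = 0}.Finite := hS.subset (Set.sep_subset _ _)
  -- The exposing functional is the sum of the normals active at h, a point of F with the fewest
  -- active constraints.
  refine ⟨∑ a ∈ hI.toFinset, a, fun k hk => ?_, ?_⟩
  · rw [sum_inner]
    exact Finset.sum_nonpos fun a ha => hk a (hI.mem_toFinset.1 ha).1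
  · ext x
    constructor
    · intro hx
      refine ⟨hsub hx, ?_⟩
      rw [sum_inner]
      refine Finset.sum_eq_zero fun a ha => ?_
      have := hI.mem_toFinset.1 ha
      exact hmin x hx a this.1 this.2
    · rintro ⟨hx, hx0⟩
      rw [sum_inner, Finset.sum_eq_zero_iff_of_nonpos
        fun a ha => hx a (hI.mem_toFinset.1 ha).1] at hx0
      -- The segment from x through h can be prolonged inside the cone, so h lies strictly between
      -- two points of the cone and extremality puts x in F.
      obtain ⟨t, ht, htw⟩ := exists_pos_add_smul_mem_polyCone hS (hsub hh) (w := h - x)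
        fun a ha ha0 => by
          rw [inner_sub_right, ha0, hx0 a (hI.mem_toFinset.2 ⟨ha, ha0⟩), sub_zero]
      refine hext hx htw hh ⟨t / (1 + t), 1 / (1 + t), by positivity, by positivity,
        by field_simp; ring, ?_⟩
      have h1 : (1 + t) ≠ 0 := by positivity
      have : h = (1 + t)⁻¹ • ((1 + t) • h) := (inv_smul_smul₀ h1 h).symm
      rw [div_eq_inv_mul, div_eq_inv_mul, mul_smul, mul_smul, ← smul_add]
      conv_rhs => rw [this]
      congr 1
      module

/-- A pair (h, y) corresponds to F₁, cut out by the constraints active at h, and F₂, the face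
exposed by y. In the other direction, y exposes F₂ and h is a point of F₁ with the fewest active
constraints. -/
theorem criticalFaceCondition_polyCone_iff [FiniteDimensional ℝ E] (A : E →ₗ[ℝ] E) {S : Set E}
    (hS : S.Finite) : CriticalFaceCondition A (polyCone S) ↔ CritNondegenerate A S := by
  constructor
  · intro H h y hy z hz hzA
    obtain ⟨hh, hyK, hy0⟩ := mem_normalCone_polyCone.1 hy
    have f₁ := isFace_polyCone (S := S) (N := {a ∈ S | ⟪a, h⟫ = 0}) fun b hb k hk => hk b hb.1
    have f₂ := isFace_polyCone (S := S) (N := {y}) fun b hb k hk => by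
      rw [Set.mem_singleton_iff.1 hb]; exact hyK k hk
    have hsub : {x ∈ polyCone S | ∀ b ∈ {a ∈ S | ⟪a, h⟫ = 0}, ⟪b, x⟫ = 0} ⊆
        {x ∈ polyCone S | ∀ b ∈ ({y} : Set E), ⟪b, x⟫ = 0} := by
      rintro x ⟨hx, hx0⟩
      refine ⟨hx, fun b hb => ?_⟩
      rw [Set.mem_singleton_iff.1 hb]
      refine le_antisymm (hyK x hx) ?_
      obtain ⟨t, ht, htw⟩ := exists_pos_add_smul_mem_polyCone hS hh (w := -x)
        fun a ha ha0 => by rw [inner_neg_right, hx0 a ⟨ha, ha0⟩, neg_zero]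
      have := hyK _ htw
      rw [inner_add_right, inner_smul_right, inner_neg_right, hy0] at this
      by_contra! hlt
      nlinarith
    have e := coneOf_sub_eq hS (h := h) (y := y) (by simp) hsub
      ⟨hh, fun b hb => hb.2⟩ fun x hx a ha ha0 => hx.2 a ⟨ha, ha0⟩
    refine H _ _ f₁ f₂ hsub z (by rw [e]; exact hz) ?_
    rw [e]
    intro w hw
    rw [LinearMap.adjoint_inner_left]
    exact hzA w hw
  · intro H F₁ F₂ f₁ f₂ hsub z hz hzA
    obtain ⟨y, hyK, hF₂⟩ := f₂.exists_eq hS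
    obtain ⟨h, hh, hmin⟩ := exists_minimal_active hS f₁.2.2.2.1 f₁.1 f₁.2.2.1
    rw [coneOf_sub_eq hS hF₂ hsub hh hmin] at hz hzA
    have hh2 := hsub hh
    rw [hF₂] at hh2
    refine H h y (mem_normalCone_polyCone.2 ⟨hh2.1, hyK, hh2.2⟩) z hz fun w hw => ?_
    have := hzA w hw
    rwa [LinearMap.adjoint_inner_left] at this

end CriticalFaces

/-! ### Covering maps from proper, open, locally injective maps -/

section Covering

/-- Two points of a covering space that are joined by a path and have the same image coincide if
the base is simply connected. -/
theorem eq_of_joined_of_simplyConnected {X Y : Type*} [TopologicalSpace X] [TopologicalSpace Y]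
    [SimplyConnectedSpace Y] {f : X → Y} (cov : IsCoveringMap f) {x u : X} (hxu : Joined x u)
    (hf : f x = f u) : x = u := by
  obtain ⟨Γ⟩ := hxu
  -- The image of Γ is a loop homotopic to the constant one, so the lifts of both from x, namely Γ
  -- and the constant path, have the same endpoint.
  let γ₀ : Path (f x) (f x) := (Γ.map cov.continuous).cast rfl hf
  let γ₁ : Path (f x) (f x) := Path.refl (f x)
  have hom : γ₀.toContinuousMap.HomotopicRel γ₁.toContinuousMap {0, 1} :=
    SimplyConnectedSpace.paths_homotopic γ₀ γ₁
  have h := cov.liftPath_apply_one_eq_of_homotopicRel hom x γ₀.source γ₁.source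
  have h0 : Γ.toContinuousMap = cov.liftPath γ₀.toContinuousMap x γ₀.source :=
    (cov.eq_liftPath_iff' γ₀.source).2 ⟨rfl, Γ.source⟩
  have h1 : ContinuousMap.const unitInterval x = cov.liftPath γ₁.toContinuousMap x γ₁.source :=
    (cov.eq_liftPath_iff' γ₁.source).2 ⟨rfl, rfl⟩
  rw [← h0, ← h1] at h
  exact h.symm.trans Γ.target

/-- A proper open map that is locally injective over `s` is a covering map on `s`. -/
theorem isCoveringMapOn_of_locally_injOn {X Y : Type*} [TopologicalSpace X]
    [TopologicalSpace Y] [T2Space X] [T2Space Y] {g : X → Y} (hg : IsProperMap g) (ho : IsOpenMap g)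
    {s : Set Y} (hloc : ∀ x, g x ∈ s → ∃ U ∈ 𝓝 x, Set.InjOn g U) : IsCoveringMapOn g s := by
  have hlh : IsLocalHomeomorphOn g (g ⁻¹' s) := by
    intro x hx
    obtain ⟨U, hU, hinj⟩ := hloc x hx
    obtain ⟨V, hVU, hV, hxV⟩ := mem_nhds_iff.1 hU
    have : Nonempty X := ⟨x⟩
    exact ⟨OpenPartialHomeomorph.ofContinuousOpen ((hinj.mono hVU).toPartialEquiv g V)
      hg.continuous.continuousOn ho hV, hxV, rfl⟩
  -- Fibers are compact by properness and discrete by local injectivity, hence finite.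
  refine hg.isClosedMap.isCoveringMapOn_of_isLocalHomeomorphOn (fun z hz => ?_) hlh
  refine (hg.isCompact_preimage isCompact_singleton).finite
    (IsDiscrete.of_openPartialHomeomorph g (x := z) subset_rfl fun e he => ?_)
  obtain ⟨φ, hφ, h⟩ := hlh e (by rw [Set.mem_preimage, Set.mem_singleton_iff.1 he]; exact hz)
  exact ⟨φ, hφ, h.symm⟩

end Covering

/-! ### Global injectivity off a subspace of high codimension -/

section Injectivity

variable {E : Type*} [NormedAddCommGroup E] [InnerProductSpace ℝ E]

theorem notMem_of_mem_segment {B : Submodule ℝ E} {p r x : E} (hp : p ∉ B)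
    (hr : r ∉ (ℝ ∙ p) ⊔ B) (hx : x ∈ segment ℝ p r) : x ∉ B := by
  obtain ⟨s, t, -, -, hst, rfl⟩ := hx
  intro hB
  by_cases ht : t = 0
  · rw [ht, add_zero] at hst
    rw [ht, hst, one_smul, zero_smul, add_zero] at hB
    exact hp hB
  · refine hr ?_
    have h1 : t • r ∈ (ℝ ∙ p) ⊔ B := by
      have : t • r = (-s) • p + (s • p + t • r) := by module
      rw [this]
      exact Submodule.add_mem_sup (Submodule.smul_mem _ _ (Submodule.mem_span_singleton_self p)) hB
    exact (Submodule.smul_mem_iff _ ht).1 h1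

theorem exists_notMem_of_finite {ι : Type*} [Finite ι] {V : ι → Submodule ℝ E}
    (hV : ∀ i, Module.finrank ℝ (V i) < Module.finrank ℝ E) : ∃ w, ∀ i, w ∉ V i := by
  by_contra! H
  obtain ⟨i, hi⟩ := Subspace.exists_eq_top_of_iUnion_eq_univ (p := V)
    (Set.eq_univ_of_forall fun w => by simpa using H w)
  have := hV i
  rw [hi, finrank_top] at this
  exact this.false

variable [FiniteDimensional ℝ E]

theorem finrank_span_singleton_sup_le (p : E) (B : Submodule ℝ E) :
    Module.finrank ℝ ↥((ℝ ∙ p) ⊔ B) ≤ 1 + Module.finrank ℝ B := by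
  have h1 := Submodule.finrank_add_le_finrank_add_finrank (ℝ ∙ p) B
  have h2 := finrank_span_le_card (R := ℝ) ({p} : Set E)
  rw [Set.toFinset_singleton, Finset.card_singleton] at h2
  omega

theorem finrank_map_span_pair_sup_le (T : E →ₗ[ℝ] E) (p r : E) (B : Submodule ℝ E) :
    Module.finrank ℝ ↥((Submodule.span ℝ {p, r}).map T ⊔ B) ≤ 2 + Module.finrank ℝ B := by
  classical
  have h1 := Submodule.finrank_add_le_finrank_add_finrank ((Submodule.span ℝ {p, r}).map T) B
  have h2 := Submodule.finrank_map_le T (Submodule.span ℝ {p, r})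
  have h3 := finrank_span_finset_le_card (R := ℝ) ({p, r} : Finset E)
  rw [Finset.coe_pair] at h3
  have h4 := Finset.card_le_two (a := p) (b := r)
  have h5 : Set.finrank ℝ ({p, r} : Set E) = Module.finrank ℝ (Submodule.span ℝ ({p, r} : Set E)) :=
    rfl
  omega

/-- The complement of the closed half-subspace `B - ℝ≥0 w` of `B ⊔ ℝ w`. -/
theorem exists_open_starConvex {B : Submodule ℝ E} {w : E} (hw : w ∉ B) :
    ∃ U : Set E, IsOpen U ∧ StarConvex ℝ w U ∧ w ∈ U ∧ (∀ b ∈ B, b ∉ U) ∧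
      ∀ u, u ∉ (ℝ ∙ w) ⊔ B → u ∈ U := by
  set e := w - B.starProjection w with he
  have heB : ∀ b ∈ B, ⟪e, b⟫ = 0 := fun b hb => by
    rw [real_inner_comm]
    exact (Submodule.mem_orthogonal B e).1 (B.sub_starProjection_mem_orthogonal w) b hb
  have hew : 0 < ⟪e, w⟫ := by
    have h1 : ⟪e, w⟫ = ⟪e, e⟫ := by
      conv_rhs => rw [he, inner_sub_right, ← he]
      rw [heB _ (B.starProjection_apply_mem w), sub_zero]
    rw [h1]
    refine real_inner_self_pos.2 fun h0 => hw ?_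
    rw [sub_eq_zero.1 h0]
    exact B.starProjection_apply_mem w
  refine ⟨{u | u ∉ (ℝ ∙ w) ⊔ B} ∪ {u | 0 < ⟪e, u⟫}, ?_, ?_, Or.inr hew, ?_, fun u hu => Or.inl hu⟩
  · refine IsOpen.union ?_ (isOpen_lt continuous_const (by fun_prop))
    exact (Submodule.closed_of_finiteDimensional ((ℝ ∙ w) ⊔ B)).isOpen_compl
  · intro u hu s t hs ht hst
    by_cases hmem : s • w + t • u ∈ (ℝ ∙ w) ⊔ B
    · right
      change 0 < ⟪e, s • w + t • u⟫
      rw [inner_add_right, inner_smul_right, inner_smul_right]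
      rcases ht.eq_or_lt with rfl | ht
      · rw [add_zero] at hst
        rw [hst]
        simpa using hew
      · have hu' : u ∈ (ℝ ∙ w) ⊔ B := by
          have h1 : t • u = (s • w + t • u) - s • w := by abel
          refine (Submodule.smul_mem_iff _ ht.ne').1 ?_
          rw [h1]
          exact Submodule.sub_mem _ hmem (Submodule.mem_sup_left
            (Submodule.smul_mem _ _ (Submodule.mem_span_singleton_self w)))
        have hu0 : 0 < ⟪e, u⟫ := hu.resolve_left fun h => h hu'
        positivity
    · exact Or.inl hmem
  · rintro b hb (h | h)
    · exact h (Submodule.mem_sup_right hb)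
    · exact (heB b hb ▸ h : (0 : ℝ) < 0).false

/-- A proper, open, piecewise linear map that is locally injective off a subspace of codimension at
least three is injective off that subspace. -/
theorem eq_of_map_eq_of_codim_three {g : E → E} (hg : IsProperMap g) (ho : IsOpenMap g)
    {B B' : Submodule ℝ E} (hB : ∀ x, g x ∈ B' ↔ x ∈ B)
    (hloc : ∀ x, x ∉ B → ∃ U ∈ 𝓝 x, Set.InjOn g U)
    (hBr : Module.finrank ℝ B + 3 ≤ Module.finrank ℝ E)
    (hBr' : Module.finrank ℝ B' + 3 ≤ Module.finrank ℝ E)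
    {ι : Type*} [Finite ι] (T : ι → E →ₗ[ℝ] E) (hT : ∀ x, ∃ i, g x = T i x)
    {p q : E} (hp : p ∉ B) (hq : q ∉ B) (hpq : g p = g q) : p = q := by
  -- A generic r makes both segments from p to r and from q to r miss B.
  obtain ⟨r, hr⟩ := exists_notMem_of_finite (V := fun b : Bool => (ℝ ∙ (bif b then p else q)) ⊔ B)
    fun b => by
      have := finrank_span_singleton_sup_le (bif b then p else q) B
      omega
  have hrp : r ∉ (ℝ ∙ p) ⊔ B := hr true
  have hrq : r ∉ (ℝ ∙ q) ⊔ B := hr false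
  -- On each segment g takes values in finitely many images of a plane. Codimension three leaves
  -- room for w outside all of these images plus B', so the image of the path p, r, q avoids ℝw + B'
  -- and stays in the contractible set U.
  obtain ⟨w, hw⟩ := exists_notMem_of_finite
    (V := fun o : ι × Bool => (Submodule.span ℝ {bif o.2 then p else q, r}).map (T o.1) ⊔ B')
    fun o => by
      have := finrank_map_span_pair_sup_le (T o.1) (bif o.2 then p else q) r B'
      omega
  have hι : Nonempty ι := (hT 0).nonempty
  have hwB : w ∉ B' := fun h => hw (Classical.arbitrary ι, true) (Submodule.mem_sup_right h)
  obtain ⟨U, hUo, hUs, hwU, hUB, hU⟩ := exists_open_starConvex hwB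
  have hseg : ∀ b : Bool, segment ℝ (bif b then p else q) r ⊆ g ⁻¹' U := by
    intro b x hx
    have hxB : x ∉ B := by
      cases b
      · exact notMem_of_mem_segment hq hrq hx
      · exact notMem_of_mem_segment hp hrp hx
    refine hU _ fun hmem => ?_
    obtain ⟨v, hv, b', hb', hsum⟩ := Submodule.mem_sup.1 hmem
    obtain ⟨c, rfl⟩ := Submodule.mem_span_singleton.1 hv
    by_cases hc : c = 0
    · rw [hc, zero_smul, zero_add] at hsum
      exact hxB ((hB x).1 (hsum ▸ hb'))
    · obtain ⟨i, hi⟩ := hT x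
      refine hw (i, b) ((Submodule.smul_mem_iff _ hc).1 ?_)
      have h1 : c • w = T i x + -b' := by rw [← hi, ← hsum]; abel
      rw [h1]
      refine Submodule.add_mem_sup (Submodule.mem_map_of_mem ?_) (B'.neg_mem hb')
      obtain ⟨s, t, -, -, -, rfl⟩ := hx
      exact Submodule.add_mem _ (Submodule.smul_mem _ _ (Submodule.subset_span (by simp)))
        (Submodule.smul_mem _ _ (Submodule.subset_span (by simp)))
  have hjoin : JoinedIn (g ⁻¹' U) p q :=
    (JoinedIn.of_segment_subset (hseg true)).trans (JoinedIn.of_segment_subset (hseg false)).symm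
  have hcov : IsCoveringMapOn g U := isCoveringMapOn_of_locally_injOn hg ho fun x hx =>
    hloc x fun hxB => hUB _ ((hB x).2 hxB) hx
  have : ContractibleSpace U := hUs.contractibleSpace ⟨w, hwU⟩
  have := eq_of_joined_of_simplyConnected hcov.isCoveringMap_restrictPreimage hjoin.joined_subtype
    (Subtype.ext hpq)
  exact congrArg Subtype.val this

/-- A proper, open map that is locally injective off a subspace of codimension at least two takes
all values off the image of the subspace several times, if it takes one of them several times. -/
theorem exists_ne_of_codim_two {g : E → E} (hg : IsProperMap g) (ho : IsOpenMap g)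
    {B' : Submodule ℝ E} (hloc : ∀ x, g x ∉ B' → ∃ U ∈ 𝓝 x, Set.InjOn g U)
    (hBr' : Module.finrank ℝ B' + 2 ≤ Module.finrank ℝ E)
    {p q z : E} (hp : g p ∉ B') (hpq : g p = g q) (hne : p ≠ q) (hz : z ∉ B') :
    ∃ p' q', g p' = z ∧ g q' = z ∧ p' ≠ q' := by
  have hcov : IsCoveringMapOn g (B' : Set E)ᶜ := isCoveringMapOn_of_locally_injOn hg ho hloc
  have hrank : 1 < Module.rank ℝ (E ⧸ B') := by
    rw [← Module.finrank_eq_rank, ← Nat.cast_one, Nat.cast_lt]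
    have := B'.finrank_quotient_add_finrank
    omega
  have hpc := isPathConnected_compl_of_one_lt_codim hrank
  have hj := (hpc.joinedIn (g p) hp z hz).joined_subtype
  obtain ⟨γ⟩ := hj
  -- The complement of a subspace of codimension at least two is path connected; monodromy along a
  -- path identifies the fibers over its endpoints.
  have hbij := hcov.isCoveringMap_restrictPreimage.monodromy_bijective
    (Path.Homotopic.Quotient.mk γ)
  set m := hcov.isCoveringMap_restrictPreimage.monodromy (Path.Homotopic.Quotient.mk γ) with hm
  have hq : g q ∉ B' := hpq ▸ hp
  let P : (Set.restrictPreimage (B' : Set E)ᶜ g) ⁻¹' {⟨g p, hp⟩} := ⟨⟨p, hp⟩, rfl⟩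
  let Q : (Set.restrictPreimage (B' : Set E)ᶜ g) ⁻¹' {⟨g p, hp⟩} :=
    ⟨⟨q, hq⟩, Subtype.ext hpq.symm⟩
  refine ⟨(m P).1.1, (m Q).1.1, congrArg Subtype.val (m P).2, congrArg Subtype.val (m Q).2,
    fun h => hne ?_⟩
  have h1 : m P = m Q := Subtype.ext (Subtype.ext h)
  exact congrArg (fun x => x.1.1) (hbij.1 h1)

end Injectivity

/-! ### Trivial directions and linear pieces of the normal map -/

section TrivialDirections

variable {E : Type*} [NormedAddCommGroup E] [InnerProductSpace ℝ E]

theorem mem_span_orthogonal_iff {S : Set E} {l : E} :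
    l ∈ (Submodule.span ℝ S)ᗮ ↔ ∀ a ∈ S, ⟪a, l⟫ = 0 := by
  rw [Submodule.mem_orthogonal]
  refine ⟨fun h a ha => h a (Submodule.subset_span ha), fun h u hu => ?_⟩
  induction hu using Submodule.span_induction with
  | mem x hx => exact h x hx
  | zero => exact inner_zero_left _
  | add x y _ _ hx hy => rw [inner_add_left, hx, hy, add_zero]
  | smul c x _ hx => rw [real_inner_smul_left, hx, mul_zero]

theorem mem_polyCone_of_mem_orthogonal {S : Set E} {l : E} (hl : l ∈ (Submodule.span ℝ S)ᗮ) :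
    l ∈ polyCone S := fun a ha => (mem_span_orthogonal_iff.1 hl a ha).le

theorem inner_eq_zero_of_mem_orthogonal {S : Set E} {l y : E} (hl : l ∈ (Submodule.span ℝ S)ᗮ)
    (hy : ∀ k ∈ polyCone S, ⟪y, k⟫ ≤ 0) : ⟪y, l⟫ = 0 := by
  have h1 := hy l (mem_polyCone_of_mem_orthogonal hl)
  have h2 := hy (-l) (mem_polyCone_of_mem_orthogonal (Submodule.neg_mem _ hl))
  rw [inner_neg_right] at h2
  linarith

theorem mem_orthogonal_of_neg_mem {S : Set E} {l : E} (h1 : l ∈ polyCone S)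
    (h2 : -l ∈ polyCone S) : l ∈ (Submodule.span ℝ S)ᗮ := by
  refine mem_span_orthogonal_iff.2 fun a ha => le_antisymm (h1 a ha) ?_
  have := h2 a ha
  rw [inner_neg_right] at this
  linarith

/-- The subspace along which the normal maps of `polyCone S` are linear: the sum of the lineality
space of the cone and the lineality space of its polar. -/
noncomputable def trivialDirections (S : Set E) : Submodule ℝ E :=
  (Submodule.span ℝ S)ᗮ ⊔ (Submodule.span ℝ (polyCone S))ᗮ

theorem mem_normalCone_of_mem_orthogonal {S : Set E} {l m : E}
    (hl : l ∈ (Submodule.span ℝ S)ᗮ) (hm : m ∈ (Submodule.span ℝ (polyCone S))ᗮ) :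
    m ∈ normalCone (polyCone S) l := by
  have h := mem_span_orthogonal_iff.1 hm
  refine mem_normalCone_polyCone.2 ⟨mem_polyCone_of_mem_orthogonal hl, fun k hk => ?_, ?_⟩
  · rw [real_inner_comm, h k hk]
  · rw [real_inner_comm, h l (mem_polyCone_of_mem_orthogonal hl)]

theorem add_mem_normalCone_polyCone {S : Set E} {h k y v : E} (hy : y ∈ normalCone (polyCone S) h)
    (hv : v ∈ normalCone (polyCone S) k) (hyk : ⟪y, k⟫ = 0) (hvh : ⟪v, h⟫ = 0) :
    y + v ∈ normalCone (polyCone S) (h + k) := by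
  obtain ⟨h1, h2, h3⟩ := mem_normalCone_polyCone.1 hy
  obtain ⟨k1, k2, k3⟩ := mem_normalCone_polyCone.1 hv
  refine mem_normalCone_polyCone.2 ⟨add_mem_polyCone h1 k1, fun w hw => ?_, ?_⟩
  · rw [inner_add_left]
    exact add_nonpos (h2 w hw) (k2 w hw)
  · rw [inner_add_left, inner_add_right, inner_add_right, h3, hyk, hvh, k3]
    simp

theorem eq_zero_of_mem_orthogonal {B : Submodule ℝ E} {x : E} (h1 : x ∈ B) (h2 : x ∈ Bᗮ) :
    x = 0 := by
  rw [← Submodule.mem_bot ℝ, ← B.inf_orthogonal_eq_bot]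
  exact ⟨h1, h2⟩

theorem eq_zero_of_neg_mem_polyCone {S : Set E} {k : E} (h1 : k ∈ polyCone S)
    (h2 : -k ∈ polyCone S) (h3 : k ∈ (trivialDirections S)ᗮ) : k = 0 :=
  eq_zero_of_mem_orthogonal (Submodule.mem_sup_left (mem_orthogonal_of_neg_mem h1 h2)) h3

variable [FiniteDimensional ℝ E]

/-- Two points lie in a common piece of linearity of `proj (polyCone S)`. -/
def SameCell (S : Set E) (x u : E) : Prop :=
  ⟪x - proj (polyCone S) x, proj (polyCone S) u⟫ = 0 ∧
    ⟪u - proj (polyCone S) u, proj (polyCone S) x⟫ = 0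

theorem SameCell.proj_add {S : Set E} {x u : E} (h : SameCell S x u) :
    proj (polyCone S) (x + u) = proj (polyCone S) x + proj (polyCone S) u := by
  have := add_mem_normalCone_polyCone (sub_proj_polyCone_mem S x) (sub_proj_polyCone_mem S u)
    h.1 h.2
  apply proj_eq_of_mem
  rwa [add_sub_add_comm]

theorem SameCell.normalMap_add (A : E →ₗ[ℝ] E) {S : Set E} {x u : E} (h : SameCell S x u) :
    normalMap A (polyCone S) (x + u) = normalMap A (polyCone S) x + normalMap A (polyCone S) u := by
  simp only [normalMap, h.proj_add, map_add]
  abel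

theorem SameCell.smul {S : Set E} {x u : E} (h : SameCell S x u) {s t : ℝ} (hs : 0 ≤ s)
    (ht : 0 ≤ t) : SameCell S (s • x) (t • u) := by
  simp only [SameCell, proj_polyCone_smul S hs, proj_polyCone_smul S ht, ← smul_sub,
    real_inner_smul_left, inner_smul_right, h.1, h.2, mul_zero, and_self]

theorem sameCell_of_mem_trivialDirections {S : Set E} (x : E) {b : E}
    (hb : b ∈ trivialDirections S) : SameCell S x b := by
  obtain ⟨l, hl, m, hm, rfl⟩ := Submodule.mem_sup.1 hb
  obtain ⟨h1, h2, -⟩ := mem_normalCone_polyCone.1 (sub_proj_polyCone_mem S x)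
  rw [SameCell, proj_add_of_mem (mem_normalCone_of_mem_orthogonal hl hm), add_sub_cancel_left]
  exact ⟨inner_eq_zero_of_mem_orthogonal hl h2, by
    rw [real_inner_comm]; exact mem_span_orthogonal_iff.1 hm _ h1⟩

/-- Additivity gives P(−x) = −P x, so the cone contains both signs of P x and its polar both signs
of x − P x. -/
theorem mem_trivialDirections_of_sameCell_neg {S : Set E} {x : E} (h : SameCell S x (-x)) :
    x ∈ trivialDirections S := by
  obtain ⟨h1, h2, -⟩ := mem_normalCone_polyCone.1 (sub_proj_polyCone_mem S x)
  obtain ⟨k1, k2, -⟩ := mem_normalCone_polyCone.1 (sub_proj_polyCone_mem S (-x))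
  have h0 := h.proj_add
  have hz : proj (polyCone S) (0 : E) = 0 := by
    simpa using proj_polyCone_smul S (le_refl (0 : ℝ)) (0 : E)
  rw [add_neg_cancel, hz] at h0
  have hn : proj (polyCone S) (-x) = -proj (polyCone S) x := (neg_eq_of_add_eq_zero_right h0.symm).symm
  rw [hn] at k1 k2
  have hx : x = proj (polyCone S) x + (x - proj (polyCone S) x) := by abel
  rw [hx]
  refine Submodule.add_mem_sup (mem_orthogonal_of_neg_mem h1 k1)
    (mem_span_orthogonal_iff.2 fun k hk => ?_)
  have e1 := h2 k hk
  have e2 := k2 k hk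
  have e3 : -x - -proj (polyCone S) x = -(x - proj (polyCone S) x) := by abel
  rw [e3, inner_neg_left] at e2
  rw [real_inner_comm]
  linarith

/-- Strictness comes from x itself: P x lies in the lineality space of the critical cone at x, and x
− P x is orthogonal to that cone. This drives the induction. -/
theorem trivialDirections_lt {S : Set E} (hS : S.Finite) {x : E} (hx : x ∉ trivialDirections S) :
    trivialDirections S < trivialDirections (critNormalsAt S x) := by
  obtain ⟨h1, h2, h3⟩ := mem_normalCone_polyCone.1 (sub_proj_polyCone_mem S x)
  set h := proj (polyCone S) x with hh
  set y := x - h with hy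
  have hcrit : critNormalsAt S x = critNormals S h y := rfl
  have hle : trivialDirections S ≤ trivialDirections (critNormalsAt S x) := by
    rw [hcrit]
    refine sup_le_sup (fun l hl => ?_) fun m hm => ?_
    · refine mem_orthogonal_of_neg_mem ?_ ?_
      · refine mem_polyCone_critNormals.2 ⟨fun a ha _ => (mem_span_orthogonal_iff.1 hl a ha).le,
          inner_eq_zero_of_mem_orthogonal hl h2⟩
      · have hl' := Submodule.neg_mem _ hl
        refine mem_polyCone_critNormals.2 ⟨fun a ha _ => (mem_span_orthogonal_iff.1 hl' a ha).le,
          inner_eq_zero_of_mem_orthogonal hl' h2⟩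
    · rw [mem_span_orthogonal_iff] at hm ⊢
      intro w hw
      obtain ⟨t, ht, htw⟩ :=
        exists_pos_add_smul_mem_polyCone hS h1 (mem_polyCone_critNormals.1 hw).1
      have e1 := hm _ htw
      rw [inner_add_left, hm h h1, zero_add, real_inner_smul_left] at e1
      exact (mul_eq_zero.1 e1).resolve_left ht.ne'
  refine lt_of_le_of_ne hle fun heq => hx ?_
  rw [heq, hcrit]
  have hx : x = h + y := by rw [hy]; abel
  rw [hx]
  refine Submodule.add_mem_sup (mem_orthogonal_of_neg_mem ?_ ?_) (mem_span_orthogonal_iff.2 ?_)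
  · exact mem_polyCone_critNormals.2 ⟨fun a _ h0 => h0.le, h3⟩
  · refine mem_polyCone_critNormals.2 ⟨fun a _ h0 => ?_, ?_⟩
    · rw [inner_neg_right, h0, neg_zero]
    · rw [inner_neg_right, h3, neg_zero]
  · intro w hw
    rw [real_inner_comm]
    exact (mem_polyCone_critNormals.1 hw).2

/-- The linear map that coincides with the normal map on the cell with active normals `I`. -/
noncomputable def pieceMap (A : E →ₗ[ℝ] E) (I : Set E) : E →ₗ[ℝ] E :=
  A ∘ₗ ((Submodule.span ℝ I)ᗮ.starProjection : E →ₗ[ℝ] E) +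
    (LinearMap.id - ((Submodule.span ℝ I)ᗮ.starProjection : E →ₗ[ℝ] E))

/-- Directions orthogonal to the active normals are feasible at P x with both signs, so x − P x is
orthogonal to them and P x is an orthogonal projection onto a subspace. -/
theorem normalMap_eq_pieceMap (A : E →ₗ[ℝ] E) {S : Set E} (hS : S.Finite) (x : E) :
    normalMap A (polyCone S) x = pieceMap A {a ∈ S | ⟪a, proj (polyCone S) x⟫ = 0} x := by
  have hN := sub_proj_polyCone_mem S x
  set h := proj (polyCone S) x with hh
  have hN' : ∀ v ∈ (Submodule.span ℝ {a ∈ S | ⟪a, h⟫ = 0})ᗮ, ⟪x - h, v⟫ ≤ 0 := by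
    intro v hv
    obtain ⟨t, ht, htv⟩ := exists_pos_add_smul_mem_polyCone hS hN.1 (w := v)
      fun a ha ha0 => (mem_span_orthogonal_iff.1 hv a ⟨ha, ha0⟩).le
    have := hN.2 _ htv
    rw [add_sub_cancel_left, inner_smul_right] at this
    exact nonpos_of_mul_nonpos_right this ht
  have hproj : (Submodule.span ℝ {a ∈ S | ⟪a, h⟫ = 0})ᗮ.starProjection x = h := by
    refine (Submodule.eq_starProjection_of_mem_of_inner_eq_zero
      (mem_span_orthogonal_iff.2 fun a ha => ha.2) fun v hv => ?_)
    refine le_antisymm (hN' v hv) ?_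
    have := hN' (-v) (Submodule.neg_mem _ hv)
    rw [inner_neg_right] at this
    linarith
  simp only [pieceMap, LinearMap.add_apply, LinearMap.comp_apply, LinearMap.sub_apply,
    LinearMap.id_apply, ContinuousLinearMap.coe_coe, hproj]
  rfl

theorem normalMap_eq_pieceMap_of_mem (A : E →ₗ[ℝ] E) {S : Set E} (hS : S.Finite) {b : E}
    (hb : b ∈ trivialDirections S) : normalMap A (polyCone S) b = pieceMap A S b := by
  rw [normalMap_eq_pieceMap A hS]
  congr 2
  obtain ⟨l, hl, m, hm, rfl⟩ := Submodule.mem_sup.1 hb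
  rw [proj_add_of_mem (mem_normalCone_of_mem_orthogonal hl hm)]
  exact Set.sep_eq_self_iff_mem_true.2 (mem_span_orthogonal_iff.1 hl)

end TrivialDirections

/-! ### Generators of the cone when few directions are nontrivial -/

section Generators

variable {E : Type*} [NormedAddCommGroup E] [InnerProductSpace ℝ E] [FiniteDimensional ℝ E]

theorem exists_add_of_mem_polyCone {S : Set E} {k : E} (hk : k ∈ polyCone S) :
    ∃ l ∈ (Submodule.span ℝ S)ᗮ, ∃ k' ∈ polyCone S, k' ∈ (trivialDirections S)ᗮ ∧ k = l + k' := by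
  set L := (Submodule.span ℝ S)ᗮ with hL
  have hl := L.starProjection_apply_mem k
  refine ⟨_, hl, k - L.starProjection k, fun a ha => ?_, ?_, by abel⟩
  · rw [inner_sub_right, mem_span_orthogonal_iff.1 hl a ha, sub_zero]
    exact hk a ha
  · rw [trivialDirections, ← Submodule.inf_orthogonal]
    refine ⟨L.sub_starProjection_mem_orthogonal k, ?_⟩
    rw [Submodule.orthogonal_orthogonal]
    exact Submodule.sub_mem _ (Submodule.subset_span hk)
      (Submodule.subset_span (mem_polyCone_of_mem_orthogonal hl))

/-- The part of the cone orthogonal to the trivial directions spans their orthogonal complement. -/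
theorem orthogonal_trivialDirections_le {S : Set E} {W : Submodule ℝ E}
    (hW : W ≤ (trivialDirections S)ᗮ)
    (h : ∀ k ∈ polyCone S, k ∈ (trivialDirections S)ᗮ → k ∈ W) : (trivialDirections S)ᗮ ≤ W := by
  have h1 : Submodule.span ℝ (polyCone S) ≤ (Submodule.span ℝ S)ᗮ ⊔ W := by
    refine Submodule.span_le.2 fun k hk => ?_
    obtain ⟨l, hl, k', hk', hk'B, rfl⟩ := exists_add_of_mem_polyCone hk
    exact Submodule.add_mem_sup hl (h k' hk' hk'B)
  intro w hw
  have hw' := hw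
  rw [trivialDirections, ← Submodule.inf_orthogonal] at hw'
  have h2 := hw'.2
  rw [SetLike.mem_coe, Submodule.orthogonal_orthogonal] at h2
  obtain ⟨l, hl, v, hv, rfl⟩ := Submodule.mem_sup.1 (h1 h2)
  have hl0 : l = 0 := by
    refine eq_zero_of_mem_orthogonal (B := trivialDirections S) (Submodule.mem_sup_left hl) ?_
    have := Submodule.sub_mem _ hw (hW hv)
    rwa [add_sub_cancel_right] at this
  rwa [hl0, zero_add]

theorem exists_mem_orthogonal_ne_zero {S : Set E} (hB : trivialDirections S ≠ ⊤) :
    ∃ k ∈ polyCone S, k ∈ (trivialDirections S)ᗮ ∧ k ≠ 0 := by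
  by_contra! H
  have h1 : (trivialDirections S)ᗮ ≤ ⊥ := orthogonal_trivialDirections_le bot_le
    fun k hk hkB => (Submodule.mem_bot ℝ).2 (H k hk hkB)
  exact hB ((Submodule.orthogonal_eq_bot_iff).1 (le_bot_iff.1 h1))

/-- Orthogonally to the trivial directions the cone lies on a line and contains no line, so it is a
ray. -/
theorem exists_generator_of_codim_one {S : Set E}
    (hr : Module.finrank ℝ (trivialDirections S) + 1 = Module.finrank ℝ E) :
    ∃ k₁ ∈ polyCone S, ∀ k ∈ polyCone S, ∃ l ∈ (Submodule.span ℝ S)ᗮ, ∃ s : ℝ, 0 ≤ s ∧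
      k = l + s • k₁ := by
  have hB : trivialDirections S ≠ ⊤ := by
    intro h
    rw [h, finrank_top] at hr
    omega
  have hr' := (trivialDirections S).finrank_add_finrank_orthogonal
  obtain ⟨k₁, hk₁, hk₁B, hne⟩ := exists_mem_orthogonal_ne_zero hB
  refine ⟨k₁, hk₁, fun k hk => ?_⟩
  obtain ⟨l, hl, k', hk', hk'B, rfl⟩ := exists_add_of_mem_polyCone hk
  refine ⟨l, hl, ?_⟩
  have h1 : Module.finrank ℝ (trivialDirections S)ᗮ = 1 := by omega
  obtain ⟨c, hc⟩ := (finrank_eq_one_iff_of_nonzero' (⟨k₁, hk₁B⟩ : (trivialDirections S)ᗮ)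
    (by simpa using hne)).1 h1 ⟨k', hk'B⟩
  have hc' : c • k₁ = k' := congrArg Subtype.val hc
  by_cases hc0 : 0 ≤ c
  · exact ⟨c, hc0, by rw [hc']⟩
  · exfalso
    push Not at hc0
    refine hne (eq_zero_of_neg_mem_polyCone hk₁ ?_ hk₁B)
    have h2 : -k₁ = (-c⁻¹) • k' := by
      rw [← hc', smul_smul, neg_mul, inv_mul_cancel₀ hc0.ne, neg_one_smul]
    rw [h2]
    exact smul_mem_polyCone hk' (neg_nonneg.2 (inv_nonpos.2 hc0.le))

theorem exists_generators_of_codim_two {S : Set E} (hS : S.Finite)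
    (hr : Module.finrank ℝ (trivialDirections S) + 2 = Module.finrank ℝ E) :
    ∃ k₁ ∈ polyCone S, ∃ k₂ ∈ polyCone S, k₁ ∉ trivialDirections S ∧
      ∀ k ∈ polyCone S, ∃ l ∈ (Submodule.span ℝ S)ᗮ, ∃ s t : ℝ, 0 ≤ s ∧ 0 ≤ t ∧
        k = l + (s • k₁ + t • k₂) := by
  set B := trivialDirections S with hBdef
  have hB : B ≠ ⊤ := by
    intro h
    rw [h, finrank_top] at hr
    omega
  have hr' := B.finrank_add_finrank_orthogonal
  have hr2 : Module.finrank ℝ Bᗮ = 2 := by omega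
  -- c is strictly negative on the nonzero points of K ∩ Bᗮ, as vanishing would put a point into the
  -- lineality space. Hence ⟪c, ·⟫ = −1 slices this planar cone in a segment, whose endpoints
  -- generate it.
  let c : E := ∑ a ∈ hS.toFinset, a
  have hc : ∀ k ∈ polyCone S, k ∈ Bᗮ → k ≠ 0 → ⟪c, k⟫ < 0 := by
    intro k hk hkB hk0
    have hnp : ∀ a ∈ hS.toFinset, ⟪a, k⟫ ≤ 0 := fun a ha => hk a (hS.mem_toFinset.1 ha)
    rw [sum_inner]
    refine lt_of_le_of_ne (Finset.sum_nonpos hnp) fun h0 => hk0 ?_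
    rw [Finset.sum_eq_zero_iff_of_nonpos hnp] at h0
    exact eq_zero_of_mem_orthogonal (B := B) (Submodule.mem_sup_left
      (mem_span_orthogonal_iff.2 fun a ha => h0 a (hS.mem_toFinset.2 ha))) hkB
  have hnorm : ∀ k ∈ polyCone S, k ∈ Bᗮ → k ≠ 0 → ∃ s : ℝ, 0 < s ∧ s • k ∈ polyCone S ∧
      s • k ∈ Bᗮ ∧ ⟪c, s • k⟫ = -1 := by
    intro k hk hkB hk0
    have h1 := hc k hk hkB hk0
    refine ⟨(-⟪c, k⟫)⁻¹, by simpa using h1, smul_mem_polyCone hk (by simpa using h1.le),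
      Submodule.smul_mem _ _ hkB, ?_⟩
    rw [inner_smul_right, inv_neg, neg_mul, inv_mul_cancel₀ h1.ne]
  obtain ⟨p, hp, hpB, hpc⟩ : ∃ p ∈ polyCone S, p ∈ Bᗮ ∧ ⟪c, p⟫ = -1 := by
    obtain ⟨k, hk, hkB, hk0⟩ := exists_mem_orthogonal_ne_zero hB
    obtain ⟨s, -, h1, h2, h3⟩ := hnorm k hk hkB hk0
    exact ⟨_, h1, h2, h3⟩
  obtain ⟨q, hq, hqB, hqc, hpq⟩ : ∃ q ∈ polyCone S, q ∈ Bᗮ ∧ ⟪c, q⟫ = -1 ∧ q ≠ p := by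
    by_contra! H
    have h1 : Bᗮ ≤ ℝ ∙ p := orthogonal_trivialDirections_le
      ((Submodule.span_singleton_le_iff_mem _ _).2 hpB) fun k hk hkB => by
        by_cases hk0 : k = 0
        · rw [hk0]; exact Submodule.zero_mem _
        obtain ⟨s, hs, h1, h2, h3⟩ := hnorm k hk hkB hk0
        refine Submodule.mem_span_singleton.2 ⟨s⁻¹, ?_⟩
        rw [← H _ h1 h2 h3, inv_smul_smul₀ hs.ne']
    have h2 := Submodule.finrank_mono h1
    have h3 := finrank_span_le_card (R := ℝ) ({p} : Set E)
    rw [Set.toFinset_singleton, Finset.card_singleton] at h3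
    omega
  set v := q - p with hv
  have hv0 : v ≠ 0 := sub_ne_zero.2 hpq
  have hvB : v ∈ Bᗮ := Submodule.sub_mem _ hqB hpB
  have hvc : ⟪c, v⟫ = 0 := by rw [hv, inner_sub_right, hqc, hpc, sub_self]
  have hspan : ∀ w ∈ Bᗮ, ∃ α β : ℝ, w = α • p + β • v := by
    have hli : LinearIndependent ℝ ![p, v] := by
      refine LinearIndependent.pair_iff.2 fun s t hst => ?_
      have h1 : ⟪c, s • p + t • v⟫ = 0 := by rw [hst, inner_zero_right]
      rw [inner_add_right, inner_smul_right, inner_smul_right, hpc, hvc] at h1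
      have hs : s = 0 := by linarith
      rw [hs, zero_smul, zero_add] at hst
      exact ⟨hs, (smul_eq_zero.1 hst).resolve_right hv0⟩
    have hle : Submodule.span ℝ (Set.range ![p, v]) ≤ Bᗮ := by
      refine Submodule.span_le.2 ?_
      rintro _ ⟨i, rfl⟩
      fin_cases i
      · exact hpB
      · exact hvB
    have heq := Submodule.eq_of_le_of_finrank_eq hle (by
      rw [finrank_span_eq_card hli, hr2, Fintype.card_fin])
    intro w hw
    rw [← heq, Matrix.range_cons, Matrix.range_cons, Matrix.range_empty, Set.union_empty,
      Set.singleton_union, Submodule.mem_span_pair] at hw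
    obtain ⟨α, β, h⟩ := hw
    exact ⟨α, β, h.symm⟩
  set J : Set ℝ := {s | p + s • v ∈ polyCone S} with hJ
  -- Such a w is not in the cone, so some constraint eventually fails along it. Applied to v and −v,
  -- this bounds the slice on both sides.
  have hbound : ∀ w ∈ Bᗮ, ⟪c, w⟫ = 0 → w ≠ 0 → ∃ M : ℝ, ∀ s : ℝ, p + s • w ∈ polyCone S → s ≤ M := by
    intro w hwB hwc hw0
    have hwK : w ∉ polyCone S := fun h => (hc w h hwB hw0).ne hwc
    simp only [polyCone, Set.mem_ofPred_eq, not_forall, not_le] at hwK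
    obtain ⟨a, ha, haw⟩ := hwK
    refine ⟨-⟪a, p⟫ / ⟪a, w⟫, fun s hs => ?_⟩
    have := hs a ha
    rw [inner_add_right, inner_smul_right] at this
    rw [le_div_iff₀ haw]
    linarith
  obtain ⟨M, hM⟩ := hbound v hvB hvc hv0
  obtain ⟨m, hm⟩ := hbound (-v) (Submodule.neg_mem _ hvB) (by rw [inner_neg_right, hvc, neg_zero])
    (neg_ne_zero.2 hv0)
  have hJc : IsCompact J := by
    refine (isCompact_Icc (a := -m) (b := M)).of_isClosed_subset
      ((isClosed_polyCone S).preimage (f := fun s : ℝ => p + s • v) (by fun_prop)) fun s hs => ?_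
    refine ⟨?_, hM s hs⟩
    have := hm (-s) (by rw [neg_smul_neg]; exact hs)
    linarith
  have h0J : (0 : ℝ) ∈ J := by simpa [hJ] using hp
  have h1J : (1 : ℝ) ∈ J := by simpa [hJ, hv] using hq
  have hs₁ := hJc.sInf_mem ⟨0, h0J⟩
  have hs₂ := hJc.sSup_mem ⟨0, h0J⟩
  have hle₁ : ∀ s ∈ J, sInf J ≤ s := fun s hs => csInf_le hJc.bddBelow hs
  have hle₂ : ∀ s ∈ J, s ≤ sSup J := fun s hs => le_csSup hJc.bddAbove hs
  set s₁ := sInf J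
  set s₂ := sSup J
  have hlt : 0 < s₂ - s₁ := by
    have := hle₁ 0 h0J
    have := hle₂ 1 h1J
    linarith
  refine ⟨p + s₁ • v, hs₁, p + s₂ • v, hs₂, fun hmem => ?_, fun k hk => ?_⟩
  · have h1 := eq_zero_of_mem_orthogonal hmem
      (Submodule.add_mem _ hpB (Submodule.smul_mem _ _ hvB))
    have h2 : ⟪c, p + s₁ • v⟫ = 0 := by rw [h1, inner_zero_right]
    rw [inner_add_right, inner_smul_right, hpc, hvc] at h2
    norm_num at h2
  · obtain ⟨l, hl, k', hk', hk'B, rfl⟩ := exists_add_of_mem_polyCone hk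
    refine ⟨l, hl, ?_⟩
    by_cases hk0 : k' = 0
    · exact ⟨0, 0, le_rfl, le_rfl, by simp [hk0]⟩
    obtain ⟨r, hr0, h1, h2, h3⟩ := hnorm k' hk' hk'B hk0
    obtain ⟨α, β, hαβ⟩ := hspan _ h2
    have hα : α = 1 := by
      rw [hαβ, inner_add_right, inner_smul_right, inner_smul_right, hpc, hvc] at h3
      linarith
    rw [hα, one_smul] at hαβ
    have hβ : β ∈ J := by rw [hαβ] at h1; exact h1
    have hβ₁ := hle₁ β hβ
    have hβ₂ := hle₂ β hβ
    -- Barycentric coordinates of β in [s₁, s₂], with r⁻¹ undoing the normalization to the slice.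
    refine ⟨r⁻¹ * ((s₂ - β) / (s₂ - s₁)), r⁻¹ * ((β - s₁) / (s₂ - s₁)),
      mul_nonneg (by positivity) (div_nonneg (by linarith) hlt.le),
      mul_nonneg (by positivity) (div_nonneg (by linarith) hlt.le), ?_⟩
    have h4 : k' = r⁻¹ • (p + β • v) := by rw [← hαβ, inv_smul_smul₀ hr0.ne']
    rw [h4, mul_smul, mul_smul, ← smul_add]
    congr 2
    match_scalars <;> field_simp <;> ring

end Generators

/-! ### Linear openness implies injectivity -/

section Uniqueness

variable {E : Type*} [NormedAddCommGroup E] [InnerProductSpace ℝ E]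

variable {A : E →ₗ[ℝ] E} {S : Set E}

/-- The normal map is locally injective off the trivial
directions. -/
structure LocallyInjectiveOffTrivial (A : E →ₗ[ℝ] E) (S : Set E) : Prop where
  finite : S.Finite
  ne_top : trivialDirections S ≠ ⊤
  locally_injOn : ∀ x ∉ trivialDirections S, ∃ U ∈ 𝓝 x, Set.InjOn (normalMap A (polyCone S)) U

namespace LocallyInjectiveOffTrivial

theorem eq_zero_of_eventually_const (h : LocallyInjectiveOffTrivial A S) {x v : E}
    (hx : x ∉ trivialDirections S)
    (hv : ∀ᶠ t : ℝ in 𝓝 0, normalMap A (polyCone S) (x + t • v) = normalMap A (polyCone S) x) :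
    v = 0 := by
  obtain ⟨U, hU, hinj⟩ := h.locally_injOn x hx
  have ht : Filter.Tendsto (fun t : ℝ => x + t • v) (𝓝 0) (𝓝 x) := by
    have : ContinuousAt (fun t : ℝ => x + t • v) 0 := by fun_prop
    simpa [ContinuousAt] using this
  obtain ⟨t, ⟨h1, h2⟩, h3⟩ := (((hv.and (ht.eventually hU)).filter_mono
    nhdsWithin_le_nhds).and (self_mem_nhdsWithin (s := Set.Ioi (0 : ℝ)))).exists
  have h4 := hinj h2 (mem_of_mem_nhds hU) h1
  rw [add_eq_left] at h4
  exact (smul_eq_zero.1 h4).resolve_left (ne_of_gt h3)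

end LocallyInjectiveOffTrivial

variable [FiniteDimensional ℝ E]

/-- The image of the trivial directions. -/
noncomputable def trivialImage (A : E →ₗ[ℝ] E) (S : Set E) : Submodule ℝ E :=
  (trivialDirections S).map (pieceMap A S)

theorem exists_mul_norm_le_of_homogeneous {g : E → E} (hg : Continuous g)
    (hhom : ∀ (t : ℝ) (x : E), 0 ≤ t → g (t • x) = t • g x) (h0 : ∀ x, g x = 0 → x = 0) :
    ∃ c > 0, ∀ x, c * ‖x‖ ≤ ‖g x‖ := by
  have : ProperSpace E := FiniteDimensional.proper ℝ E
  obtain ⟨c, hc, H⟩ : ∃ c > 0, ∀ x ∈ Metric.sphere (0 : E) 1, c ≤ ‖g x‖ := by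
    rcases (Metric.sphere (0 : E) 1).eq_empty_or_nonempty with he | hne
    · exact ⟨1, one_pos, by simp [he]⟩
    · obtain ⟨m, hm, hmin⟩ := (isCompact_sphere (0 : E) 1).exists_isMinOn hne
        hg.norm.continuousOn
      refine ⟨‖g m‖, norm_pos_iff.2 fun h => ?_, fun x hx => hmin hx⟩
      rw [h0 m h] at hm
      simp at hm
  refine ⟨c, hc, fun x => ?_⟩
  by_cases hx : x = 0
  · simp [hx]
  · have hx0 : 0 < ‖x‖ := norm_pos_iff.2 hx
    have h1 := H (‖x‖⁻¹ • x) (by simp [norm_smul, hx0.ne'])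
    rw [hhom _ _ (by positivity), norm_smul, norm_inv, norm_norm, le_inv_mul_iff₀ hx0] at h1
    linarith

theorem isProperMap_of_homogeneous {g : E → E} (hg : Continuous g)
    (hhom : ∀ (t : ℝ) (x : E), 0 ≤ t → g (t • x) = t • g x) (h0 : ∀ x, g x = 0 → x = 0) :
    IsProperMap g := by
  have : ProperSpace E := FiniteDimensional.proper ℝ E
  obtain ⟨c, hc, H⟩ := exists_mul_norm_le_of_homogeneous hg hhom h0
  refine isProperMap_iff_tendsto_cocompact.2 ⟨hg, ?_⟩
  rw [← Metric.cobounded_eq_cocompact, ← tendsto_norm_atTop_iff_cobounded]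
  exact Filter.tendsto_atTop_mono H (tendsto_norm_cobounded_atTop.const_mul_atTop hc)

theorem normalMap_add_of_mem_trivialDirections (x : E) {b : E} (hb : b ∈ trivialDirections S) :
    normalMap A (polyCone S) (x + b) = normalMap A (polyCone S) x + normalMap A (polyCone S) b :=
  (sameCell_of_mem_trivialDirections x hb).normalMap_add A

namespace LocallyInjectiveOffTrivial

/-- A nonzero kernel point would make f constant along a short segment off B: in direction x through
a point off B if x is trivial, along the ray of x otherwise. -/
theorem eq_zero_of_map_eq_zero (h : LocallyInjectiveOffTrivial A S) {x : E}
    (hx : normalMap A (polyCone S) x = 0) : x = 0 := by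
  by_cases hxB : x ∈ trivialDirections S
  · obtain ⟨u, hu⟩ : ∃ u, u ∉ trivialDirections S := by
      by_contra! H
      exact h.ne_top (Submodule.eq_top_iff'.2 H)
    refine h.eq_zero_of_eventually_const hu (Filter.Eventually.of_forall fun t => ?_)
    rw [normalMap_add_of_mem_trivialDirections _ (Submodule.smul_mem _ _ hxB),
      normalMap_eq_pieceMap_of_mem A h.finite (Submodule.smul_mem _ _ hxB), map_smul,
      ← normalMap_eq_pieceMap_of_mem A h.finite hxB, hx, smul_zero, add_zero]
  · refine h.eq_zero_of_eventually_const hxB ?_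
    filter_upwards [eventually_ge_nhds (show (-1 : ℝ) < 0 by norm_num)] with t ht
    have e : x + t • x = (1 + t) • x := by module
    rw [e, normalMap_polyCone_smul _ _ _ _ (by linarith), hx, smul_zero]

theorem map_mem_iff (h : LocallyInjectiveOffTrivial A S) (x : E) :
    normalMap A (polyCone S) x ∈ trivialImage A S ↔ x ∈ trivialDirections S := by
  constructor
  · rintro ⟨b, hb, hbx⟩
    have hb' : -b ∈ trivialDirections S := Submodule.neg_mem _ hb
    have h1 := normalMap_add_of_mem_trivialDirections (A := A) x hb'
    rw [normalMap_eq_pieceMap_of_mem A h.finite hb', map_neg, hbx, add_neg_cancel] at h1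
    have h2 := h.eq_zero_of_map_eq_zero h1
    rw [add_neg_eq_zero.1 h2]
    exact hb
  · intro hx
    rw [normalMap_eq_pieceMap_of_mem A h.finite hx]
    exact Submodule.mem_map_of_mem hx

theorem isProperMap (h : LocallyInjectiveOffTrivial A S) : IsProperMap (normalMap A (polyCone S)) :=
  isProperMap_of_homogeneous (continuous_normalMap_polyCone A S) (normalMap_polyCone_smul A S)
    fun _ => h.eq_zero_of_map_eq_zero

theorem finrank_image_le : Module.finrank ℝ (trivialImage A S) ≤
    Module.finrank ℝ (trivialDirections S) :=
  Submodule.finrank_map_le _ _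

theorem not_sameCell_of_map_eq_neg (h : LocallyInjectiveOffTrivial A S) {x u : E}
    (hx : x ∉ trivialDirections S)
    (hu : normalMap A (polyCone S) u = -normalMap A (polyCone S) x) : ¬SameCell S x u := by
  intro hc
  have h1 := hc.normalMap_add A
  rw [hu, add_neg_cancel] at h1
  have h2 := (neg_eq_of_add_eq_zero_right (h.eq_zero_of_map_eq_zero h1)).symm
  rw [h2] at hc
  exact hx (mem_trivialDirections_of_sameCell_neg hc)

/-- In a common cell f is additive on nonnegative combinations, so it would be constant near x + u
in the direction x − u, contradicting local injectivity there. -/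
theorem not_sameCell_of_map_eq (h : LocallyInjectiveOffTrivial A S) {x u : E}
    (hx : x ∉ trivialDirections S)
    (hu : normalMap A (polyCone S) x = normalMap A (polyCone S) u) (hne : x ≠ u) :
    ¬SameCell S x u := by
  intro hc
  have key : ∀ s t : ℝ, 0 ≤ s → 0 ≤ t → normalMap A (polyCone S) (s • x + t • u) =
      (s + t) • normalMap A (polyCone S) x := by
    intro s t hs ht
    rw [(hc.smul hs ht).normalMap_add, normalMap_polyCone_smul _ _ _ _ hs,
      normalMap_polyCone_smul _ _ _ _ ht, ← hu, add_smul]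
  have h2 : normalMap A (polyCone S) (x + u) = (2 : ℝ) • normalMap A (polyCone S) x := by
    have := key 1 1 zero_le_one zero_le_one
    rwa [one_smul, one_smul, one_add_one_eq_two] at this
  have hm : x + u ∉ trivialDirections S := by
    rw [← h.map_mem_iff, h2, Submodule.smul_mem_iff _ two_ne_zero, h.map_mem_iff]
    exact hx
  refine hne (sub_eq_zero.1 (h.eq_zero_of_eventually_const hm ?_))
  filter_upwards [eventually_ge_nhds (show (-1 : ℝ) < 0 by norm_num),
    eventually_le_nhds (show (0 : ℝ) < 1 by norm_num)] with t ht1 ht2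
  have e : x + u + t • (x - u) = (1 + t) • x + (1 - t) • u := by module
  rw [e, key _ _ (by linarith) (by linarith), h2]
  congr 1
  ring

end LocallyInjectiveOffTrivial

/-- In a cone with two generators, the cell of a point is determined by which generators are
orthogonal to its normal component. -/
theorem sameCell_of_generators {k₁ k₂ : E} (hk₁ : k₁ ∈ polyCone S) (hk₂ : k₂ ∈ polyCone S)
    (hgen : ∀ k ∈ polyCone S, ∃ l ∈ (Submodule.span ℝ S)ᗮ, ∃ s t : ℝ, 0 ≤ s ∧ 0 ≤ t ∧
      k = l + (s • k₁ + t • k₂)) {x u : E}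
    (h₁ : ⟪x - proj (polyCone S) x, k₁⟫ = 0 ↔ ⟪u - proj (polyCone S) u, k₁⟫ = 0)
    (h₂ : ⟪x - proj (polyCone S) x, k₂⟫ = 0 ↔ ⟪u - proj (polyCone S) u, k₂⟫ = 0) :
    SameCell S x u := by
  have key : ∀ x u : E,
      (⟪x - proj (polyCone S) x, k₁⟫ = 0 ↔ ⟪u - proj (polyCone S) u, k₁⟫ = 0) →
      (⟪x - proj (polyCone S) x, k₂⟫ = 0 ↔ ⟪u - proj (polyCone S) u, k₂⟫ = 0) →
      ⟪x - proj (polyCone S) x, proj (polyCone S) u⟫ = 0 := by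
    intro x u h₁ h₂
    obtain ⟨-, hy, -⟩ := mem_normalCone_polyCone.1 (sub_proj_polyCone_mem S x)
    obtain ⟨hp, hv, hv0⟩ := mem_normalCone_polyCone.1 (sub_proj_polyCone_mem S u)
    obtain ⟨l, hl, s, t, hs, ht, hk⟩ := hgen _ hp
    rw [hk, inner_add_right, inner_add_right, inner_smul_right, inner_smul_right,
      inner_eq_zero_of_mem_orthogonal hl hy, zero_add]
    have e0 : ⟪u - proj (polyCone S) u, l + (s • k₁ + t • k₂)⟫ = 0 := by rw [← hk, hv0]
    rw [inner_add_right, inner_add_right, inner_smul_right, inner_smul_right,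
      inner_eq_zero_of_mem_orthogonal hl hv, zero_add] at e0
    have e1 := mul_nonpos_of_nonneg_of_nonpos hs (hv k₁ hk₁)
    have e2 := mul_nonpos_of_nonneg_of_nonpos ht (hv k₂ hk₂)
    have f1 : s * ⟪x - proj (polyCone S) x, k₁⟫ = 0 := by
      rcases mul_eq_zero.1 (show s * ⟪u - proj (polyCone S) u, k₁⟫ = 0 by linarith) with h | h
      · rw [h, zero_mul]
      · rw [h₁.2 h, mul_zero]
    have f2 : t * ⟪x - proj (polyCone S) x, k₂⟫ = 0 := by
      rcases mul_eq_zero.1 (show t * ⟪u - proj (polyCone S) u, k₂⟫ = 0 by linarith) with h | h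
      · rw [h, zero_mul]
      · rw [h₂.2 h, mul_zero]
    rw [f1, f2, add_zero]
  exact ⟨key x u h₁ h₂, key u x h₁.symm h₂.symm⟩

namespace LocallyInjectiveOffTrivial

/-- With one generator there are at most two classes of cells, yet p, q and a preimage of −f(p)
would lie in pairwise different ones. -/
theorem eq_of_map_eq_of_codim_one (h : LocallyInjectiveOffTrivial A S)
    (hO : LinearlyOpen (normalMap A (polyCone S)))
    (hr : Module.finrank ℝ (trivialDirections S) + 1 = Module.finrank ℝ E) {p q : E}
    (hp : p ∉ trivialDirections S)
    (hpq : normalMap A (polyCone S) p = normalMap A (polyCone S) q) : p = q := by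
  by_contra hne
  obtain ⟨k, hk, hgen⟩ := exists_generator_of_codim_one hr
  have hgen' : ∀ k' ∈ polyCone S, ∃ l ∈ (Submodule.span ℝ S)ᗮ, ∃ s t : ℝ, 0 ≤ s ∧ 0 ≤ t ∧
      k' = l + (s • k + t • k) := fun k' hk' => by
    obtain ⟨l, hl, s, hs, e⟩ := hgen k' hk'
    exact ⟨l, hl, s, 0, hs, le_rfl, by rw [e, zero_smul, add_zero]⟩
  obtain ⟨r, hr⟩ := hO.surjective (-normalMap A (polyCone S) p)
  have hq : q ∉ trivialDirections S := by
    rw [← h.map_mem_iff, ← hpq, h.map_mem_iff]; exact hp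
  have n1 := mt (fun c => sameCell_of_generators hk hk hgen' c c)
    (h.not_sameCell_of_map_eq hp hpq hne)
  have n2 := mt (fun c => sameCell_of_generators hk hk hgen' c c)
    (h.not_sameCell_of_map_eq_neg hp hr)
  have n3 := mt (fun c => sameCell_of_generators hk hk hgen' c c)
    (h.not_sameCell_of_map_eq_neg hq (hpq ▸ hr))
  tauto

/-- By monodromy, f(k₁) has a second preimage u and −f(k₁) has two preimages. None of these three
shares a cell with k₁, so all have normal components not orthogonal to k₁. Only orthogonality to k₂
can then separate them, which is two classes for three pairwise separated points. -/
theorem eq_of_map_eq_of_codim_two (h : LocallyInjectiveOffTrivial A S)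
    (hO : LinearlyOpen (normalMap A (polyCone S)))
    (hr : Module.finrank ℝ (trivialDirections S) + 2 = Module.finrank ℝ E) {p q : E}
    (hp : p ∉ trivialDirections S)
    (hpq : normalMap A (polyCone S) p = normalMap A (polyCone S) q) : p = q := by
  by_contra hne
  obtain ⟨k₁, hk₁, k₂, hk₂, hk₁B, hgen⟩ := exists_generators_of_codim_two h.finite hr
  have hr' : Module.finrank ℝ (trivialImage A S) + 2 ≤ Module.finrank ℝ E := by
    have := finrank_image_le (A := A) (S := S)
    omega
  have htwo : ∀ z ∉ trivialImage A S, ∃ p' q', normalMap A (polyCone S) p' = z ∧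
      normalMap A (polyCone S) q' = z ∧ p' ≠ q' := fun z hz =>
    exists_ne_of_codim_two h.isProperMap hO.isOpenMap
      (fun x hx => h.locally_injOn x (mt (h.map_mem_iff x).2 hx)) hr'
      (mt (h.map_mem_iff p).1 hp) hpq hne hz
  have hz := mt (h.map_mem_iff k₁).1 hk₁B
  obtain ⟨u, hu, huk⟩ : ∃ u, normalMap A (polyCone S) u = normalMap A (polyCone S) k₁ ∧ u ≠ k₁ := by
    obtain ⟨p', q', h1, h2, h3⟩ := htwo _ hz
    by_cases hpk : p' = k₁
    · exact ⟨q', h2, fun e => h3 (hpk.trans e.symm)⟩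
    · exact ⟨p', h1, hpk⟩
  obtain ⟨r₁, r₂, hr₁, hr₂, hr₁₂⟩ := htwo (-normalMap A (polyCone S) k₁)
    (mt (Submodule.neg_mem_iff _).1 hz)
  have huB : u ∉ trivialDirections S := by
    rw [← h.map_mem_iff, hu]; exact hz
  have hr₁B : r₁ ∉ trivialDirections S := by
    rw [← h.map_mem_iff, hr₁, Submodule.neg_mem_iff]; exact hz
  have hproj : proj (polyCone S) k₁ = k₁ := proj_eq_of_mem (mem_normalCone_polyCone.2
    ⟨hk₁, fun k _ => by rw [sub_self, inner_zero_left], by rw [sub_self, inner_zero_left]⟩)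
  have hcell : ∀ x, ¬SameCell S k₁ x → ¬⟪x - proj (polyCone S) x, k₁⟫ = 0 := fun x hx h0 =>
    hx (by rw [SameCell, hproj, sub_self, inner_zero_left]; exact ⟨rfl, h0⟩)
  have c1 := hcell u (h.not_sameCell_of_map_eq hk₁B hu.symm (Ne.symm huk))
  have c2 := hcell r₁ (h.not_sameCell_of_map_eq_neg hk₁B hr₁)
  have c3 := hcell r₂ (h.not_sameCell_of_map_eq_neg hk₁B hr₂)
  have n1 := mt (sameCell_of_generators hk₁ hk₂ hgen (iff_of_false c1 c2))
    (h.not_sameCell_of_map_eq_neg huB (by rw [hu, hr₁]))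
  have n2 := mt (sameCell_of_generators hk₁ hk₂ hgen (iff_of_false c1 c3))
    (h.not_sameCell_of_map_eq_neg huB (by rw [hu, hr₂]))
  have n3 := mt (sameCell_of_generators hk₁ hk₂ hgen (iff_of_false c2 c3))
    (h.not_sameCell_of_map_eq hr₁B (by rw [hr₁, hr₂]) hr₁₂)
  tauto

theorem eq_of_map_eq_of_three_le_codim (h : LocallyInjectiveOffTrivial A S)
    (hO : LinearlyOpen (normalMap A (polyCone S)))
    (hr : Module.finrank ℝ (trivialDirections S) + 3 ≤ Module.finrank ℝ E) {p q : E}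
    (hp : p ∉ trivialDirections S)
    (hpq : normalMap A (polyCone S) p = normalMap A (polyCone S) q) : p = q := by
  have hfin : Finite {I : Set E // I ⊆ S} := h.finite.finite_subsets
  refine eq_of_map_eq_of_codim_three h.isProperMap hO.isOpenMap h.map_mem_iff h.locally_injOn hr
    ?_ (fun I : {I : Set E // I ⊆ S} => pieceMap A I.1) (fun x => ⟨⟨_, Set.sep_subset _ _⟩,
      normalMap_eq_pieceMap A h.finite x⟩) hp ?_ hpq
  · have := finrank_image_le (A := A) (S := S)
    omega
  · rw [← h.map_mem_iff, ← hpq, h.map_mem_iff]; exact hp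

theorem injective (h : LocallyInjectiveOffTrivial A S) (hO : LinearlyOpen (normalMap A (polyCone S))) :
    Function.Injective (normalMap A (polyCone S)) := by
  intro p q hpq
  by_cases hp : p ∈ trivialDirections S
  · have hq : q ∈ trivialDirections S := by
      rw [← h.map_mem_iff, ← hpq, h.map_mem_iff]; exact hp
    have hq' := Submodule.neg_mem _ hq
    have h1 := normalMap_add_of_mem_trivialDirections (A := A) p hq'
    rw [normalMap_eq_pieceMap_of_mem A h.finite hq', map_neg,
      ← normalMap_eq_pieceMap_of_mem A h.finite hq, hpq, add_neg_cancel] at h1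
    exact add_neg_eq_zero.1 (h.eq_zero_of_map_eq_zero h1)
  · have hlt := Submodule.finrank_lt h.ne_top
    rcases (show Module.finrank ℝ (trivialDirections S) + 1 = Module.finrank ℝ E ∨
      Module.finrank ℝ (trivialDirections S) + 2 = Module.finrank ℝ E ∨
      Module.finrank ℝ (trivialDirections S) + 3 ≤ Module.finrank ℝ E by omega) with hr | hr | hr
    · exact h.eq_of_map_eq_of_codim_one hO hr hp hpq
    · exact h.eq_of_map_eq_of_codim_two hO hr hp hpq
    · exact h.eq_of_map_eq_of_three_le_codim hO hr hp hpq

end LocallyInjectiveOffTrivial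

/-- A linearly open normal map of a polyhedral cone is injective. -/
theorem LinearlyOpen.injective_normalMap {A : E →ₗ[ℝ] E} {S : Set E} (hS : S.Finite)
    (hO : LinearlyOpen (normalMap A (polyCone S))) :
    Function.Injective (normalMap A (polyCone S)) := by
  induction hd : Module.finrank ℝ E - Module.finrank ℝ (trivialDirections S)
    using Nat.strong_induction_on generalizing S with
  | _ d ih =>
  by_cases htop : trivialDirections S = ⊤
  · have hlin : normalMap A (polyCone S) = pieceMap A S := funext fun x =>
      normalMap_eq_pieceMap_of_mem A hS (htop ▸ Submodule.mem_top)
    have hsurj := hO.surjective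
    rw [hlin] at hsurj ⊢
    exact LinearMap.injective_iff_surjective.2 hsurj
  · refine LocallyInjectiveOffTrivial.injective ⟨hS, htop, fun x hx => ?_⟩ hO
    -- The local model at x has smaller codimension and is still linearly open, so by induction it
    -- is injective, and f is injective near x.
    have hlt := Submodule.finrank_lt_finrank_of_lt (trivialDirections_lt hS hx)
    have hle := Submodule.finrank_le (trivialDirections (critNormalsAt S x))
    have hinj := ih (Module.finrank ℝ E - Module.finrank ℝ (trivialDirections (critNormalsAt S x)))
      (by omega) (finite_critNormals hS _ _)
      (linearlyOpen_critNormalsAt hS hO x) rfl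
    obtain ⟨ε, hε, H⟩ := Metric.eventually_nhds_iff.1 (eventually_normalMap_polyCone_add A hS x)
    refine ⟨Metric.ball x ε, Metric.ball_mem_nhds x hε, fun u hu v hv huv => ?_⟩
    have h1 := H (y := u - x) (by simpa [dist_eq_norm] using hu)
    have h2 := H (y := v - x) (by simpa [dist_eq_norm] using hv)
    rw [add_sub_cancel] at h1 h2
    rw [h1, h2] at huv
    exact sub_left_injective (hinj (add_left_cancel huv))

end Uniqueness

/-! ### Transfer between the variational inequality and its normal map -/

section Solutions

variable {E : Type*} [NormedAddCommGroup E] [InnerProductSpace ℝ E]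

theorem mem_solutionMap_iff {A : E →ₗ[ℝ] E} {C : Set E} {x z : E} :
    x ∈ solutionMap A C z ↔ z - A x ∈ normalCone C x := by
  constructor
  · rintro ⟨y, hy, rfl⟩
    rwa [add_sub_cancel_left]
  · intro h
    exact ⟨_, h, by abel⟩

theorem proj_of_mem_solutionMap {A : E →ₗ[ℝ] E} {C : Set E} {x z : E}
    (h : x ∈ solutionMap A C z) : proj C (x + (z - A x)) = x :=
  proj_add_of_mem (mem_solutionMap_iff.1 h)

theorem normalMap_of_mem_solutionMap {A : E →ₗ[ℝ] E} {C : Set E} {x z : E}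
    (h : x ∈ solutionMap A C z) : normalMap A C (x + (z - A x)) = z := by
  rw [normalMap_add_of_mem A (mem_solutionMap_iff.1 h)]
  abel

theorem eq_add_of_normalMap_eq {A : E →ₗ[ℝ] E} {C : Set E} {u z : E} (h : normalMap A C u = z) :
    u = proj C u + (z - A (proj C u)) := by
  rw [← h, normalMap]
  abel

variable [FiniteDimensional ℝ E]

theorem norm_add_sub_sub_le (A : E →ₗ[ℝ] E) (h h' z z' : E) :
    ‖h' + (z' - A h') - (h + (z - A h))‖ ≤
      (1 + ‖A.toContinuousLinearMap‖) * ‖h' - h‖ + ‖z' - z‖ := by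
  have e : h' + (z' - A h') - (h + (z - A h)) = (h' - h) + (z' - z) - A (h' - h) := by
    rw [map_sub]; abel
  have h1 : ‖A (h' - h)‖ ≤ ‖A.toContinuousLinearMap‖ * ‖h' - h‖ :=
    A.toContinuousLinearMap.le_opNorm (h' - h)
  rw [e]
  calc ‖(h' - h) + (z' - z) - A (h' - h)‖ ≤ ‖(h' - h) + (z' - z)‖ + ‖A (h' - h)‖ := norm_sub_le _ _
    _ ≤ ‖h' - h‖ + ‖z' - z‖ + ‖A (h' - h)‖ := by gcongr; exact norm_add_le _ _
    _ ≤ _ := by linarith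

variable {A : E →ₗ[ℝ] E} {C : Set E}

theorem proj_mem_solutionMap (hne : C.Nonempty) (hcl : IsClosed C) (hcv : Convex ℝ C) {u z : E}
    (h : normalMap A C u = z) : proj C u ∈ solutionMap A C z := by
  refine mem_solutionMap_iff.2 ?_
  have e : z - A (proj C u) = u - proj C u := by rw [← h, normalMap]; abel
  rw [e]
  exact sub_proj_mem hne hcl hcv u

theorem tendsto_proj_normalMap (hne : C.Nonempty) (hcl : IsClosed C) (hcv : Convex ℝ C)
    {xbar zbar : E} (hsol : xbar ∈ solutionMap A C zbar) :
    Filter.Tendsto (proj C) (𝓝 (xbar + (zbar - A xbar))) (𝓝 xbar) ∧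
      Filter.Tendsto (normalMap A C) (𝓝 (xbar + (zbar - A xbar))) (𝓝 zbar) :=
  ⟨(continuous_proj hne hcl hcv).tendsto' _ _ (proj_of_mem_solutionMap hsol),
    (continuous_normalMap A hne hcl hcv).tendsto' _ _ (normalMap_of_mem_solutionMap hsol)⟩

theorem MetricallyRegularNear.linearlyOpenNear (hne : C.Nonempty) (hcl : IsClosed C)
    (hcv : Convex ℝ C) {xbar zbar : E} (h : MetricallyRegularNear (viMap A C) xbar zbar) :
    LinearlyOpenNear (normalMap A C) (xbar + (zbar - A xbar)) := by
  obtain ⟨hsol : xbar ∈ solutionMap A C zbar, κ, -, H⟩ := h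
  set M := ‖A.toContinuousLinearMap‖
  refine ⟨(1 + M) * (κ + 1) + 1, by positivity, ?_⟩
  obtain ⟨t1, -⟩ := tendsto_proj_normalMap hne hcl hcv hsol
  rw [normalMap_of_mem_solutionMap hsol]
  have t3 := (t1.prodMap (Filter.tendsto_id (x := 𝓝 zbar)))
  rw [← nhds_prod_eq, ← nhds_prod_eq] at t3
  filter_upwards [t3.eventually H] with p hp
  obtain ⟨u, z⟩ := p
  dsimp only [Prod.map, id] at hp ⊢
  by_cases hz : z = normalMap A C u
  · exact ⟨u, hz.symm, by rw [sub_self, norm_zero]; positivity⟩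
  have hmem : normalMap A C u ∈ viMap A C (proj C u) := proj_mem_solutionMap hne hcl hcv rfl
  have hd : 0 < ‖z - normalMap A C u‖ := norm_pos_iff.2 (sub_ne_zero.2 hz)
  -- Replacing κ by κ + 1 makes the bound strict, so an actual solution h' can be chosen; this is
  -- why z = f(u) was treated separately.
  have h1 : Metric.infEDist (proj C u) (inv (viMap A C) z) <
      ENNReal.ofReal ((κ + 1) * ‖z - normalMap A C u‖) := by
    calc Metric.infEDist (proj C u) (inv (viMap A C) z)
        ≤ (κ : ℝ≥0∞) * Metric.infEDist z (viMap A C (proj C u)) := hp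
      _ ≤ (κ : ℝ≥0∞) * edist z (normalMap A C u) := by
          gcongr; exact Metric.infEDist_le_edist_of_mem hmem
      _ = ENNReal.ofReal (κ * ‖z - normalMap A C u‖) := by
          rw [edist_dist, dist_eq_norm, ENNReal.ofReal_mul κ.coe_nonneg, ENNReal.ofReal_coe_nnreal]
      _ < _ := by
          refine (ENNReal.ofReal_lt_ofReal_iff (by positivity)).2 ?_
          linarith
  obtain ⟨h', hh', hlt⟩ := Metric.infEDist_lt_iff.1 h1
  rw [edist_dist, ENNReal.ofReal_lt_ofReal_iff (by positivity), dist_comm, dist_eq_norm] at hlt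
  refine ⟨h' + (z - A h'), normalMap_of_mem_solutionMap hh', ?_⟩
  have h2 := norm_add_sub_sub_le A (proj C u) h' (normalMap A C u) z
  rw [← eq_add_of_normalMap_eq (A := A) (C := C) (u := u) rfl] at h2
  have h3 : (1 + M) * ‖h' - proj C u‖ ≤ (1 + M) * ((κ + 1) * ‖z - normalMap A C u‖) := by
    gcongr
  linarith

theorem SingleValuedLipschitzAround.linearlyOpenNear (hne : C.Nonempty) (hcl : IsClosed C)
    (hcv : Convex ℝ C) {xbar zbar : E} (hsol : xbar ∈ solutionMap A C zbar)
    (h : SingleValuedLipschitzAround (solutionMap A C) xbar zbar) :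
    LinearlyOpenNear (normalMap A C) (xbar + (zbar - A xbar)) := by
  obtain ⟨ε, hε, V, hV, s, L, hL, hs⟩ := h
  set M := ‖A.toContinuousLinearMap‖
  refine ⟨(1 + M) * L + 1, by positivity, ?_⟩
  obtain ⟨t1, t2⟩ := tendsto_proj_normalMap hne hcl hcv hsol
  rw [normalMap_of_mem_solutionMap hsol]
  have e1 := ((t1.eventually (Metric.ball_mem_nhds xbar hε)).and (t2.eventually hV)).prod_mk hV
  rw [← nhds_prod_eq] at e1
  filter_upwards [e1] with p hp
  obtain ⟨u, z⟩ := p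
  obtain ⟨⟨hu, huV⟩, hz⟩ := hp
  dsimp only at hu huV hz ⊢
  have h1 : proj C u ∈ solutionMap A C (normalMap A C u) ∩ Metric.ball xbar ε :=
    ⟨proj_mem_solutionMap hne hcl hcv rfl, hu⟩
  rw [hs _ huV, Set.mem_singleton_iff] at h1
  have h2 : s z ∈ solutionMap A C z ∩ Metric.ball xbar ε := by rw [hs _ hz]; rfl
  refine ⟨s z + (z - A (s z)), normalMap_of_mem_solutionMap h2.1, ?_⟩
  have h3 := norm_add_sub_sub_le A (proj C u) (s z) (normalMap A C u) z
  rw [← eq_add_of_normalMap_eq (A := A) (C := C) (u := u) rfl] at h3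
  have h4 := hL.dist_le_mul z hz _ huV
  rw [dist_eq_norm, dist_eq_norm, ← h1] at h4
  have h5 : (1 + M) * ‖s z - proj C u‖ ≤ (1 + M) * (L * ‖z - normalMap A C u‖) := by gcongr
  linarith

/-- Local injectivity of the normal map gives disjointness of the values of the variational
mapping. -/
theorem StronglyRegularNear.of_injOn {xbar zbar : E}
    (h : MetricallyRegularNear (viMap A C) xbar zbar) {U : Set E}
    (hU : U ∈ 𝓝 (xbar + (zbar - A xbar))) (hinj : Set.InjOn (normalMap A C) U) :
    StronglyRegularNear (viMap A C) xbar zbar := by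
  refine ⟨h, ?_⟩
  have hA : Continuous A := A.continuous_of_finiteDimensional
  have t : Filter.Tendsto (fun p : E × E => p.1 + (p.2 - A p.1)) (𝓝 (xbar, zbar))
      (𝓝 (xbar + (zbar - A xbar))) :=
    Continuous.tendsto' (by fun_prop) _ _ rfl
  have h1 := t.eventually hU
  rw [nhds_prod_eq, Filter.eventually_prod_iff] at h1
  obtain ⟨P, hP, Q, hQ, hPQ⟩ := h1
  obtain ⟨δ, hδ, hball⟩ := Metric.eventually_nhds_iff.1 hQ
  refine ⟨δ, hδ, {x | P x}, hP, fun x hx u hu hne => Set.eq_empty_of_forall_notMem ?_⟩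
  rintro z ⟨⟨hzx, hzu⟩, hz⟩
  have hzx' : x ∈ solutionMap A C z := hzx
  have hzu' : u ∈ solutionMap A C z := hzu
  have h2 := hinj (hPQ hx (hball hz)) (hPQ hu (hball hz))
    ((normalMap_of_mem_solutionMap hzx').trans (normalMap_of_mem_solutionMap hzu').symm)
  dsimp only at h2
  exact hne (by rw [← proj_of_mem_solutionMap hzx', h2, proj_of_mem_solutionMap hzu'])

/-- The solution mapping inherits single-valuedness and the Lipschitz property from the inverse of
the local model of the normal map. -/
theorem singleValuedLipschitzAround_of_model (hne : C.Nonempty) (hcl : IsClosed C)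
    (hcv : Convex ℝ C) {xbar zbar : E} (hsol : xbar ∈ solutionMap A C zbar) {g : E → E}
    (hg : ∀ᶠ u in 𝓝 (0 : E), normalMap A C (xbar + (zbar - A xbar) + u) = zbar + g u)
    (hO : LinearlyOpen g) (hinj : Function.Injective g) :
    SingleValuedLipschitzAround (solutionMap A C) xbar zbar := by
  obtain ⟨κ, hκ, H⟩ := hO
  obtain ⟨ρ, hρ, hball⟩ := Metric.eventually_nhds_iff.1 hg
  set M := ‖A.toContinuousLinearMap‖
  set w := xbar + (zbar - A xbar) with hw
  have hM : 0 ≤ M := norm_nonneg _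
  have hg0 : g 0 = 0 := by
    have := hg.self_of_nhds
    rwa [add_zero, normalMap_of_mem_solutionMap hsol, left_eq_add] at this
  -- G is the inverse of g; openness together with injectivity makes it Lipschitz with constant κ.
  choose G hG using fun z => H 0 z
  have hgG : ∀ z, g (G z) = z := fun z => (hG z).1
  have hGL : ∀ z z', ‖G z - G z'‖ ≤ κ * ‖z - z'‖ := by
    intro z z'
    obtain ⟨v, hv, hle⟩ := H (G z') z
    rw [hgG] at hle
    rwa [hinj (hv.trans (hgG z).symm)] at hle
  have hG0 : G 0 = 0 := hinj ((hgG 0).trans hg0.symm)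
  set ε := ρ / (2 * (1 + M)) with hε
  have hε0 : 0 < ε := by positivity
  -- With (1 + M)ε = ρ/2, the bound ρ/2 keeps every nearby solution where the model is valid. The
  -- bound ρ/κ does so for G(z − zbar), and ε/κ keeps the constructed solution within ε of xbar.
  set η := min (ρ / 2) (min (ρ / κ) (ε / κ)) with hη
  have hη0 : 0 < η := by positivity
  refine ⟨ε, hε0, Metric.ball zbar η, Metric.ball_mem_nhds _ hη0,
    fun z => proj C (w + G (z - zbar)), ⟨κ, hκ.le⟩, ?_, fun z hz => ?_⟩
  · refine LipschitzOnWith.of_dist_le_mul fun z _ z' _ => ?_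
    rw [dist_eq_norm, dist_eq_norm]
    calc ‖proj C (w + G (z - zbar)) - proj C (w + G (z' - zbar))‖
        ≤ ‖w + G (z - zbar) - (w + G (z' - zbar))‖ := norm_proj_sub_le hne hcl hcv _ _
      _ = ‖G (z - zbar) - G (z' - zbar)‖ := by rw [add_sub_add_left_eq_sub]
      _ ≤ κ * ‖z - zbar - (z' - zbar)‖ := hGL _ _
      _ = κ * ‖z - z'‖ := by rw [sub_sub_sub_cancel_right]
  · rw [mem_ball_iff_norm] at hz
    have hGz : ‖G (z - zbar)‖ ≤ κ * ‖z - zbar‖ := by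
      have := hGL (z - zbar) 0
      rwa [hG0, sub_zero, sub_zero] at this
    have hlt : ∀ r, 0 < r → η ≤ r / κ → ‖G (z - zbar)‖ < r := by
      intro r _ hr
      calc ‖G (z - zbar)‖ ≤ κ * ‖z - zbar‖ := hGz
        _ < κ * (r / κ) := by gcongr; exact hz.trans_le hr
        _ = r := by field_simp
    have h1 : normalMap A C (w + G (z - zbar)) = z := by
      rw [hball (y := G (z - zbar)) (by
        rw [dist_zero_right]
        exact hlt ρ hρ ((min_le_right _ _).trans (min_le_left _ _))), hgG]
      abel
    ext x
    simp only [Set.mem_inter_iff, Set.mem_singleton_iff]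
    constructor
    · rintro ⟨hx, hxb⟩
      rw [mem_ball_iff_norm] at hxb
      set u := x + (z - A x) - w with hu
      have h2 : ‖u‖ < ρ := by
        have h3 := norm_add_sub_sub_le A xbar x zbar z
        have h4 : (1 + M) * ‖x - xbar‖ < (1 + M) * ε := by gcongr
        have h5 : (1 + M) * ε = ρ / 2 := by rw [hε]; field_simp
        have h6 : η ≤ ρ / 2 := min_le_left _ _
        rw [← hw, ← hu] at h3
        linarith
      have h3 := hball (y := u) (by rwa [dist_zero_right])
      rw [hu, add_sub_cancel, normalMap_of_mem_solutionMap hx, ← hu] at h3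
      have h4 : u = G (z - zbar) := hinj (by rw [hgG, h3, add_sub_cancel_left])
      rw [← h4, hu, add_sub_cancel, proj_of_mem_solutionMap hx]
    · rintro rfl
      refine ⟨proj_mem_solutionMap hne hcl hcv h1, ?_⟩
      rw [mem_ball_iff_norm]
      have h2 := norm_proj_sub_le hne hcl hcv (w + G (z - zbar)) w
      rw [add_sub_cancel_left, hw, proj_of_mem_solutionMap hsol] at h2
      exact h2.trans_lt (hlt ε hε0 ((min_le_right _ _).trans (min_le_right _ _)))

end Solutions

end LinearVI

/-! ### Regularity of the linear variational inequality -/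

theorem theorem2 (n : ℕ)
    (A : EuclideanSpace ℝ (Fin n) →ₗ[ℝ] EuclideanSpace ℝ (Fin n))
    (C : Set (EuclideanSpace ℝ (Fin n))) (hC : LinearVI.IsPolyhedral C)
    (xbar zbar : EuclideanSpace ℝ (Fin n))
    (hsol : xbar ∈ LinearVI.solutionMap A C zbar) :
    (LinearVI.MetricallyRegularNear (LinearVI.viMap A C) xbar zbar →
      LinearVI.StronglyRegularNear (LinearVI.viMap A C) xbar zbar) ∧
    (LinearVI.SingleValuedLipschitzAround (LinearVI.solutionMap A C) xbar zbar ↔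
      LinearVI.CriticalFaceCondition A
        (LinearVI.criticalCone C xbar (zbar - A xbar))) := by
  open LinearVI in
  obtain ⟨k, a, α, -, hCa⟩ := hC
  replace hCa : C = polyhedron a α := hCa
  have hx : xbar ∈ C := (mem_solutionMap_iff.1 hsol).1
  have hne : C.Nonempty := ⟨xbar, hx⟩
  have hcl : IsClosed C := hCa ▸ isClosed_polyhedron a α
  have hcv : Convex ℝ C := hCa ▸ convex_polyhedron a α
  obtain ⟨S, hS, hK⟩ : ∃ S : Set (EuclideanSpace ℝ (Fin n)), S.Finite ∧
      criticalCone C xbar (zbar - A xbar) = polyCone S := by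
    rw [hCa] at hx ⊢
    exact ⟨_, ((Set.toFinite _).image a).union (by simp), criticalCone_polyhedron _ hx⟩
  have hg : ∀ᶠ u in 𝓝 (0 : EuclideanSpace ℝ (Fin n)),
      normalMap A C (xbar + (zbar - A xbar) + u) = zbar + normalMap A (polyCone S) u := by
    have h1 : ∀ᶠ u in 𝓝 (0 : EuclideanSpace ℝ (Fin n)),
        normalMap A C (xbar + (zbar - A xbar) + u) =
          normalMap A C (xbar + (zbar - A xbar)) +
            normalMap A (criticalCone C (proj C (xbar + (zbar - A xbar)))
              (xbar + (zbar - A xbar) - proj C (xbar + (zbar - A xbar)))) u := by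
      rw [hCa] at hne ⊢
      exact eventually_normalMap_add A hne _
    rwa [proj_of_mem_solutionMap hsol, normalMap_of_mem_solutionMap hsol, add_sub_cancel_left,
      hK] at h1
  have hopen : LinearlyOpenNear (normalMap A C) (xbar + (zbar - A xbar)) →
      LinearlyOpen (normalMap A (polyCone S)) := fun h =>
    (h.of_eventually_eq (continuous_normalMap A hne hcl hcv)
      (by rwa [normalMap_of_mem_solutionMap hsol])).linearlyOpen (normalMap_polyCone_smul A S)
  rw [hK, criticalFaceCondition_polyCone_iff A hS]
  refine ⟨fun h => ?_, fun h => ?_, fun h => ?_⟩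
  · have hinj := (hopen (h.linearlyOpenNear hne hcl hcv)).injective_normalMap hS
    obtain ⟨ε, hε, H⟩ := Metric.eventually_nhds_iff.1 hg
    refine StronglyRegularNear.of_injOn h (Metric.ball_mem_nhds _ hε) fun u hu v hv huv => ?_
    have h1 := H (y := u - (xbar + (zbar - A xbar))) (by simpa [dist_eq_norm] using hu)
    have h2 := H (y := v - (xbar + (zbar - A xbar))) (by simpa [dist_eq_norm] using hv)
    rw [add_sub_cancel] at h1 h2
    rw [h1, h2] at huv
    exact sub_left_injective (hinj (add_left_cancel huv))
  · exact (hopen (h.linearlyOpenNear hne hcl hcv hsol)).critNondegenerate hS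
  · exact singleValuedLipschitzAround_of_model hne hcl hcv hsol hg (h.linearlyOpen hS)
      ((h.linearlyOpen hS).injective_normalMap hS)
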